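/- Setting. Let $SU(2)$ act on $\mathcal H=(\mathbb C^2)^{\otimes N}$ by $g\mapsto g^{\otimes N}$. For $j=0,\dots,\lfloor N/2\rfloor$ let $\mathcal H_\mu\cong\mathcal Q_\mu\otimes\mathcal P_\mu$, $\mu=(N-j,j)$, be the isotypic component of the irreducible representation $\mathcal Q_\mu$ of dimension $N-2j+1$ (these are the blocks of the Schur–Weyl decomposition $\mathcal H\cong\bigoplus_\mu \mathcal Q_\mu\otimes\mathcal P_\mu$), and let $D_\mu=\dim\mathcal H_\mu=d_\mu m_\mu$. Let $H$ be a non-empty set of labels $\mu$ and $L=|H|$. Let $O$ be a Hermitian operator on $\mathcal H$ that is a direct sum $O=\bigoplus_{\mu\in H}O_\mu$ of traceless operators $O_\mu$ on the blocks $\mathcal H_\mu$, $\mu\in H$, and is zero on the other blocks. Consider the parameterized states $$|\psi(\alpha,\theta)\rangle=\bigoplus_{\mu\in H}c_\mu(\alpha)\,U_\mu(\theta_\mu)|\phi_\mu\rangle ,$$ where: - $|\phi_\mu\rangle\in\mathcal H_\mu$ is a fixed unit vector; - $U_\mu(\theta_\mu)$ is a circuit on $\mathcal H_\mu$ made of fixed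 unitaries and of rotation gates $e^{-i\theta_{\mu,l}G_{\mu,l}/2}$ with Hermitian generators, $G_{\mu,l}^2=I$, one parameter for each gate; - the amplitudes $c_\mu(\alpha)$, $\alpha\in\mathbb R^{L-1}$, are those prepared by the balanced binary tree of controlled $R_y(2\alpha)$-rotations with $L$ leaves labelled by $H$ in any order: $c_\mu(\alpha)$ is the product, over the branching nodes on the path to the leaf $\mu$, of $\cos$ or $\sin$ of the angle of the node. Leaves are numbered $0,\dots,L-1$; at depth $k$ the leaves are grouped by their residue modulo $2^k$, and a group with at least two leaves is split by the next binary digit, with its own angle. The angles $\alpha$ and $\theta$ are independent and uniform on $[0,2\pi]$, and with uniform angles each $U_\mu(\theta_\mu)$ is a unitary 2-design on $\mathcal H_\mu$. Let $C(\alpha,\theta)=\langle\psi(\alpha,\theta)|O|\psi(\alpha,\theta)\rangle$, and let $\partial C$ be its partial derivative with respect to any one of the parameters $\alpha_i$, $\theta_{\mu,l}$. Claim. For every real polynomial $Q$ there is a constant $K>0$, depending only on $Q$, such that for all $N$, all $H$ with $D_\mu\le Q(N)$ for every $\mu\in H$, and all circuits and observables as above: $C$ is differentiable, every $\partial C$ is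 square integrable, and $$\mathbb E_{\alpha,\theta}[\partial C]=0,\qquad \mathrm{Var}_{\alpha,\theta}[\partial C]\le\frac{K\,\|O\|^2}{L\,(N+1)},\qquad \mathrm{Var}_{\alpha,\theta}[\partial C]\le\frac{K\,\|O\|^2}{L\,\min_{\mu\in H}D_\mu};$$ moreover, for the parameters of the circuit on a block $\mu\in H$, $$\mathrm{Var}_{\alpha,\theta}[\partial_{\theta_{\mu,l}}C]\le\frac{2\,\|O\|^2}{L\,D_\mu}.$$ In particular, if $\|O\|^2$ is at most polynomial in $\log\mathrm{Poly}(N)$, then $\mathrm{Var}_{\alpha,\theta}[\partial C]\in O\!\left(\frac{\mathrm{Poly}(\log \mathrm{Poly}(N))}{L\,\mathrm{Poly}(N)}\right)$. -/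

import Mathlib

open MeasureTheory ProbabilityTheory
open scoped Matrix

noncomputable section

namespace LCQNN

/-! ### The `SU(2)`-action on `N` qubits and its isotypic blocks -/

/-- The Hilbert space `(ℂ²)^{⊗ N}` of `N` qubits, written in the computational basis. -/
abbrev Qubits (N : ℕ) : Type := EuclideanSpace ℂ (Fin N → Fin 2)

/-- The operator `g^{⊗ N}` on `(ℂ²)^{⊗ N}`. -/
def tensorPower (N : ℕ) (g : Matrix (Fin 2) (Fin 2) ℂ) : Qubits N →ₗ[ℂ] Qubits N :=
  Matrix.toEuclideanLin (Matrix.of fun x y : Fin N → Fin 2 => ∏ i, g (x i) (y i))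

/-- `S` is stable under `g^{⊗ N}` for every `g ∈ SU(2)`. -/
def IsInvariant {N : ℕ} (S : Submodule ℂ (Qubits N)) : Prop :=
  ∀ g ∈ Matrix.specialUnitaryGroup (Fin 2) ℂ, ∀ v ∈ S, tensorPower N g v ∈ S

/-- `S` is an irreducible subrepresentation of `(ℂ²)^{⊗ N}`. -/
def IsIrreducible {N : ℕ} (S : Submodule ℂ (Qubits N)) : Prop :=
  IsInvariant S ∧ S ≠ ⊥ ∧ ∀ T ≤ S, IsInvariant T → T = ⊥ ∨ T = S

/-- The block `𝒬_μ ⊗ 𝒫_μ ⊆ (ℂ²)^{⊗ N}` of the Young diagram `μ = (N - j, j)`, `0 ≤ j ≤ ⌊N/2⌋`: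
the isotypic component of the irreducible representation `𝒬_μ` of `SU(2)` labelled by `μ`. As
`SU(2)` has, up to equivalence, exactly one irreducible representation in each dimension and
`dim 𝒬_μ = N - 2 j + 1`, it is the sum of all irreducible subrepresentations of that dimension. -/
def block (N : ℕ) (j : Fin (N / 2 + 1)) : Submodule ℂ (Qubits N) :=
  sSup {S | IsIrreducible S ∧ Module.finrank ℂ S = N - 2 * (j : ℕ) + 1}

/-- The dimension `d_μ m_μ` of the block `𝒬_μ ⊗ 𝒫_μ`. -/
def blockDim (N : ℕ) (j : Fin (N / 2 + 1)) : ℕ := Module.finrank ℂ (block N j)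

/-- The observable `O` is a direct sum `⨁_{μ ∈ H} O_μ` of Hermitian operators `O_μ` on the blocks
with label in `H` (and zero on the rest of the space), each of them traceless. -/
structure IsBlockObservable {N : ℕ} (H : Finset (Fin (N / 2 + 1)))
    (O : Qubits N →L[ℂ] Qubits N) : Prop where
  selfAdjoint : IsSelfAdjoint O
  mapsTo : ∀ μ ∈ H, ∀ v ∈ block N μ, O v ∈ block N μ
  supported : ∀ v ∈ (⨆ μ ∈ H, block N μ)ᗮ, O v = 0
  traceless : ∀ (μ : Fin (N / 2 + 1)) (hμ : μ ∈ H),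
    LinearMap.trace ℂ (block N μ) ((O : Qubits N →ₗ[ℂ] Qubits N).restrict (mapsTo μ hμ)) = 0

/-! ### Unitary 2-designs -/

instance (n : ℕ) : MeasurableSpace (Matrix.unitaryGroup (Fin n) ℂ) := borel _

instance (n : ℕ) : BorelSpace (Matrix.unitaryGroup (Fin n) ℂ) := ⟨rfl⟩

/-- The random unitary `U` (over the probability space `(Ω, P)`) is a unitary 2-design: all its
moments of degree `(2, 2)` are those of the Haar probability measure on the unitary group. (That
measure is unique; it is called `ν` here.) -/
def IsTwoDesign {Ω : Type} [MeasurableSpace Ω] (P : Measure Ω) {n : ℕ}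
    (U : Ω → Matrix (Fin n) (Fin n) ℂ) : Prop :=
  ∃ ν : Measure (Matrix.unitaryGroup (Fin n) ℂ), ν.IsHaarMeasure ∧ IsProbabilityMeasure ν ∧
    ∀ a₁ b₁ a₂ b₂ a₃ b₃ a₄ b₄ : Fin n,
      ∫ ω, U ω a₁ b₁ * U ω a₂ b₂ * star (U ω a₃ b₃) * star (U ω a₄ b₄) ∂P =
        ∫ V, (V : Matrix (Fin n) (Fin n) ℂ) a₁ b₁ * (V : Matrix (Fin n) (Fin n) ℂ) a₂ b₂ *
          star ((V : Matrix (Fin n) (Fin n) ℂ) a₃ b₃) *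
          star ((V : Matrix (Fin n) (Fin n) ℂ) a₄ b₄) ∂ν

/-! ### The parameterized circuit -/

/-- The uniform distribution of an angle on `[0, 2π]`. -/
def angleLaw : Measure ℝ := cond volume (Set.Icc 0 (2 * Real.pi))

/-- Independent uniform angles indexed by `ι`. -/
def anglesLaw (ι : Type) [Fintype ι] : Measure (ι → ℝ) := Measure.pi fun _ => angleLaw

/-- The amplitude of the basis state `|j⟩`, `0 ≤ j < L`, in the output of the coefficient layer,
a binary tree of controlled `R_y(2α)` rotations with `L` leaves and one rotation for each of the
`L - 1` branching nodes. At depth `k` the path to the leaf `j` is in the node `2 ^ k + j % 2 ^ k`,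
which branches if and only if this number is `< L`; the bit `k` of `j` then selects the factor
`cos α` or `sin α`, for the angle `α` of that node. When `L = 2 ^ t` this is
`∏_{k < t} (cos α_{j_k}) ^ (1 - j_k) (sin α_{j_k}) ^ (j_k)`. -/
def amplitude (L : ℕ) (α : Fin (L - 1) → ℝ) (j : Fin L) : ℝ :=
  ∏ k ∈ Finset.range L,
    if h : 2 ^ k + (j : ℕ) % 2 ^ k < L then
      if (j : ℕ).testBit k then
        Real.sin (α ⟨2 ^ k + (j : ℕ) % 2 ^ k - 1,
          Nat.sub_lt_sub_right (Nat.le_add_right_of_le Nat.one_le_two_pow) h⟩)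
      else
        Real.cos (α ⟨2 ^ k + (j : ℕ) % 2 ^ k - 1,
          Nat.sub_lt_sub_right (Nat.le_add_right_of_le Nat.one_le_two_pow) h⟩)
    else 1

/-- A linear combination of quantum neural networks over the blocks with label in `H`. -/
structure Network (N : ℕ) (H : Finset (Fin (N / 2 + 1))) where
  /-- the block controlled by each basis state of the control register -/
  label : Fin H.card ≃ H
  /-- an orthonormal basis of each block, the columns of the Schur transform -/
  basis : ∀ μ : H, OrthonormalBasis (Fin (blockDim N μ)) ℂ (block N μ)
  /-- the number of rotation gates in the circuit on the block -/
  gates : H → ℕ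
  /-- the generators `G` of the rotation gates `exp (-i θ G / 2)` -/
  gen : ∀ μ : H, Fin (gates μ) → Matrix (Fin (blockDim N μ)) (Fin (blockDim N μ)) ℂ
  gen_hermitian : ∀ μ l, (gen μ l).IsHermitian
  gen_sq : ∀ μ l, gen μ l * gen μ l = 1
  /-- the parameter-free gates between the rotations -/
  fixed : ∀ μ : H, Fin (gates μ + 1) → Matrix.unitaryGroup (Fin (blockDim N μ)) ℂ
  /-- the initial state of the block -/
  init : ∀ μ : H, Fin (blockDim N μ) → ℂ
  init_norm : ∀ μ, ∑ a, ‖init μ a‖ ^ 2 = 1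

namespace Network

variable {N : ℕ} {H : Finset (Fin (N / 2 + 1))} (A : Network N H)

/-- The labels of all the parameters: `Sum.inl` for the angles `α` of the coefficient layer,
`Sum.inr` for the angles `θ_μ` of the circuits on the blocks. -/
abbrev Param : Type := Fin (H.card - 1) ⊕ (Σ μ : H, Fin (A.gates μ))

/-- The circuit `U_μ(θ_μ) = W_0 R_1(θ_1) W_1 R_2(θ_2) W_2 ⋯` with `R_l(θ) = exp (-i θ G_l / 2)`. -/
def circuit (μ : H) (θ : Fin (A.gates μ) → ℝ) :
    Matrix (Fin (blockDim N μ)) (Fin (blockDim N μ)) ℂ :=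
  (A.fixed μ 0 : Matrix (Fin (blockDim N μ)) (Fin (blockDim N μ)) ℂ) *
    (List.ofFn fun l : Fin (A.gates μ) =>
      NormedSpace.exp ((-(Complex.I * (θ l : ℂ) / 2)) • A.gen μ l) *
        (A.fixed μ l.succ : Matrix (Fin (blockDim N μ)) (Fin (blockDim N μ)) ℂ)).prod

/-- The state `|ψ_μ⟩ = U_μ(θ_μ)|init_μ⟩` of the block `μ`, as a vector of `(ℂ²)^{⊗ N}`. -/
def blockState (μ : H) (θ : Fin (A.gates μ) → ℝ) : Qubits N :=
  ∑ a, (A.circuit μ θ *ᵥ A.init μ) a • (A.basis μ a : Qubits N)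

/-- The state `|ψ(α, θ)⟩ = ⨁_{μ ∈ H} c_μ(α) |ψ_μ(θ_μ)⟩`. -/
def state (x : A.Param → ℝ) : Qubits N :=
  ∑ μ : H, ((amplitude H.card (fun i => x (Sum.inl i)) (A.label.symm μ) : ℝ) : ℂ) •
    A.blockState μ (fun l => x (Sum.inr ⟨μ, l⟩))

/-- The cost function `C(α, θ) = ⟨ψ(α, θ)|O|ψ(α, θ)⟩`. -/
def cost (O : Qubits N →L[ℂ] Qubits N) (x : A.Param → ℝ) : ℝ :=
  (inner ℂ (A.state x) (O (A.state x))).re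

/-- The component of the gradient of the cost along the parameter `i`. -/
def partialCost (O : Qubits N →L[ℂ] Qubits N) (i : A.Param) (x : A.Param → ℝ) : ℝ :=
  deriv (fun t : ℝ => A.cost O (Function.update x i t)) (x i)

/-- The law of the parameters: all angles are independent and uniform. -/
def law : Measure (A.Param → ℝ) := anglesLaw A.Param

/-- The circuits on the blocks, with independent uniform angles, are unitary 2-designs. -/
def BlocksAreTwoDesigns : Prop :=
  ∀ μ : H, IsTwoDesign (anglesLaw (Fin (A.gates μ))) (A.circuit μ)

end Network

end LCQNN

end

/-! `O` preserves the mutually orthogonal blocks, so the cost is `C = ∑ c_μ(α)² ⟨ψ_μ|O|ψ_μ⟩`. In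
each single angle `C` is a sinusoid `a + b cos (ω t) + c sin (ω t)`, with `ω = 1` for a gate angle
and `ω = 2` for an angle of the tree. The derivative of a sinusoid has mean zero over the period,
and its mean square is at most `ω²` times that of the function (`integral_deriv_update_sq_le`). It
remains to bound second moments.

By independence the second moment of a summand is `E[c_μ⁴] E[⟨ψ_μ|O|ψ_μ⟩²]`. Each path has at least
`Nat.log 2 L` branching nodes with distinct angles, and `cos⁴`, `sin⁴` have mean `3/8`, so the first
factor is at most `(3/8) ^ Nat.log 2 L ≤ 2 / L`. The design property turns the second factor into a
Haar moment, equal to `tr (M²) / (D (D + 1)) ≤ ‖O‖² / (D + 1)` for the compression `M` of `O` to the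
block. The Haar moments follow from invariance, polarization and normalization. A gate angle enters
one summand only, which settles the gate parameters.

An angle of the tree may enter many summands, and Cauchy–Schwarz only gives `4 L² ‖O‖² / min D`. The
factor `1 / L` is recovered because `L` is bounded in terms of `Q` (`exists_card_le`). Indeed,
highest weight vectors with `j` ones generate irreducible subrepresentations of dimension `N - 2 j +
1`, hence lie in the block, and rank–nullity for the raising operator gives `D ≥ C(N, j) - C(N, j -
1)` for `j ≥ 1`. So a large label exceeds `Q(N)` unless `N` is bounded. The same estimate, together
with `D ≥ N + 1` for `j = 0`, yields `N + 1 ≤ 4 D`, which converts `min D` into `N + 1`. -/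

namespace LCQNN

/-! ### Independent uniform angles -/

instance : IsProbabilityMeasure angleLaw := by
  refine cond_isProbabilityMeasure_of_finite ?_ ?_
  · simp [Real.volume_Icc, Real.pi_pos]
  · simp [Real.volume_Icc, -ENNReal.ofReal_mul]

instance (ι : Type) [Fintype ι] : IsProbabilityMeasure (anglesLaw ι) := by
  unfold anglesLaw; infer_instance

theorem integral_angleLaw (g : ℝ → ℝ) :
    ∫ t, g t ∂angleLaw = (2 * Real.pi)⁻¹ * ∫ t in (0 : ℝ)..(2 * Real.pi), g t := by
  have hpi := Real.pi_pos
  rw [angleLaw, ProbabilityTheory.cond, integral_smul_measure, Real.volume_Icc,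
    integral_Icc_eq_integral_Ioc, intervalIntegral.integral_of_le (by positivity), smul_eq_mul,
    ENNReal.toReal_inv, sub_zero, ENNReal.toReal_ofReal (by positivity)]

/-- Marginals of a product of probability measures: a box pulls back to a box that is unconstrained
off the range of `e`, where each factor has mass one. -/
theorem measurePreserving_comp_injective {ι κ : Type} [Fintype ι] [Fintype κ] (e : κ → ι)
    (he : Function.Injective e) :
    MeasurePreserving (fun x : ι → ℝ => fun k => x (e k)) (anglesLaw ι) (anglesLaw κ) := by
  classical
  refine ⟨by fun_prop, ?_⟩
  refine (Measure.pi_eq fun s hs => ?_).symm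
  rw [Measure.map_apply (by fun_prop) (MeasurableSet.univ_pi hs)]
  let t : ι → Set ℝ := fun i => if h : ∃ k, e k = i then s h.choose else Set.univ
  have ht : ∀ k, t (e k) = s k := by
    intro k
    have h : ∃ k', e k' = e k := ⟨k, rfl⟩
    have : h.choose = k := he h.choose_spec
    simp only [t, dif_pos h, this]
  have hpre : (fun x : ι → ℝ => fun k => x (e k)) ⁻¹' Set.univ.pi s = Set.univ.pi t := by
    ext x
    simp only [Set.mem_preimage, Set.mem_univ_pi]
    constructor
    · intro h i
      by_cases hi : ∃ k, e k = i
      · obtain ⟨k, rfl⟩ := hi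
        rw [ht]; exact h k
      · simp [t, dif_neg hi]
    · intro h k
      rw [← ht]; exact h (e k)
  rw [hpre, anglesLaw, Measure.pi_pi]
  rw [← Finset.prod_subset (Finset.subset_univ (Finset.univ.map ⟨e, he⟩))]
  · simp [ht]
  · intro i _ hi
    have hi' : ¬ ∃ k, e k = i := by simpa using hi
    simp [t, dif_neg hi']

/-- Resampling one angle does not change the law, so one angle can be averaged with the others held
fixed. -/
theorem measurePreserving_update {ι : Type} [Fintype ι] [DecidableEq ι] (i : ι) :
    MeasurePreserving (fun p : (ι → ℝ) × ℝ => Function.update p.1 i p.2)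
      ((anglesLaw ι).prod angleLaw) (anglesLaw ι) := by
  have hm : Measurable (fun p : (ι → ℝ) × ℝ => Function.update p.1 i p.2) := by
    refine measurable_pi_lambda _ fun k => ?_
    by_cases h : k = i
    · subst h; simpa using measurable_snd
    · simp only [Function.update_of_ne h]; fun_prop
  refine ⟨hm, (Measure.pi_eq fun s hs => ?_).symm⟩
  rw [Measure.map_apply hm (MeasurableSet.univ_pi hs)]
  have hpre : (fun p : (ι → ℝ) × ℝ => Function.update p.1 i p.2) ⁻¹' Set.univ.pi s =
      (Set.univ.pi (Function.update s i Set.univ)) ×ˢ s i := by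
    ext ⟨x, t⟩
    simp only [Set.mem_preimage, Set.mem_univ_pi, Set.mem_prod]
    constructor
    · intro h
      refine ⟨fun k => ?_, by simpa using h i⟩
      by_cases hk : k = i
      · subst hk; simp
      · simpa [Function.update_of_ne hk] using h k
    · rintro ⟨h, ht⟩ k
      by_cases hk : k = i
      · subst hk; simpa using ht
      · simpa [Function.update_of_ne hk] using h k
  rw [hpre, Measure.prod_prod, anglesLaw, Measure.pi_pi, ← Finset.mul_prod_erase _ _ (Finset.mem_univ i),
    ← Finset.mul_prod_erase (s := Finset.univ) (f := fun k => angleLaw (s k)) (h := Finset.mem_univ i)]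
  simp only [Function.update_self, measure_univ, one_mul]
  rw [mul_comm]
  congr 1
  refine Finset.prod_congr rfl fun k hk => ?_
  rw [Function.update_of_ne (Finset.ne_of_mem_erase hk)]

/-- Independence of disjoint groups of angles; it will separate the amplitude of a block from its
circuit. -/
theorem integral_mul_of_disjoint_coordinates {ι κ κ' : Type} [Fintype ι] [Fintype κ] [Fintype κ']
    (e : κ ⊕ κ' → ι) (he : Function.Injective e) (f : (κ → ℝ) → ℝ) (g : (κ' → ℝ) → ℝ)
    (hf : Measurable f) (hg : Measurable g) :
    ∫ x, f (fun k => x (e (Sum.inl k))) * g (fun k => x (e (Sum.inr k))) ∂anglesLaw ι =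
      (∫ x, f x ∂anglesLaw κ) * ∫ x, g x ∂anglesLaw κ' := by
  have h1 := measurePreserving_comp_injective e he
  have h2 : MeasurePreserving (MeasurableEquiv.sumPiEquivProdPi fun _ : κ ⊕ κ' => ℝ).symm
      ((anglesLaw κ).prod (anglesLaw κ')) (anglesLaw (κ ⊕ κ')) :=
    measurePreserving_sumPiEquivProdPi_symm (fun _ => angleLaw)
  let F : (κ ⊕ κ' → ℝ) → ℝ := fun y => f (fun k => y (Sum.inl k)) * g (fun k => y (Sum.inr k))
  have hF : Measurable F := by
    refine Measurable.mul (hf.comp ?_) (hg.comp ?_) <;> fun_prop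
  calc _ = ∫ y, F y ∂anglesLaw (κ ⊕ κ') := by
        rw [← h1.map_eq, integral_map h1.measurable.aemeasurable hF.aestronglyMeasurable]
    _ = ∫ p, f p.1 * g p.2 ∂((anglesLaw κ).prod (anglesLaw κ')) := by
        rw [← h2.map_eq, integral_map h2.measurable.aemeasurable hF.aestronglyMeasurable]
        rfl
    _ = _ := integral_prod_mul f g

/-- Averaging over one angle first. -/
theorem integral_eq_integral_update {ι : Type} [Fintype ι] [DecidableEq ι] (i : ι)
    (g : (ι → ℝ) → ℝ) (hg : Integrable g (anglesLaw ι)) :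
    ∫ x, g x ∂anglesLaw ι = ∫ x, (∫ t, g (Function.update x i t) ∂angleLaw) ∂anglesLaw ι := by
  have h := measurePreserving_update (ι := ι) i
  rw [← integral_prod (f := fun p : (ι → ℝ) × ℝ => g (Function.update p.1 i p.2))
    (h.integrable_comp_of_integrable hg)]
  conv_lhs => rw [← h.map_eq]
  rw [integral_map h.measurable.aemeasurable]
  rw [h.map_eq]; exact hg.aestronglyMeasurable

/-! ### Trigonometric polynomials of degree one -/

theorem deriv_sinusoid (ω a b c t : ℝ) :
    deriv (fun t : ℝ => a + b * Real.cos (ω * t) + c * Real.sin (ω * t)) t =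
      0 + (ω * c) * Real.cos (ω * t) + (-(ω * b)) * Real.sin (ω * t) := by
  have hid : HasDerivAt (fun t : ℝ => ω * t) ω t := by
    simpa using (hasDerivAt_id t).const_mul ω
  have hd := (((hasDerivAt_const t a).add (hid.cos.const_mul b)).add (hid.sin.const_mul c))
  refine hd.deriv.trans ?_
  ring

/-- `g t = a + b cos (ω t) + c sin (ω t)`. -/
def IsSinusoid (ω : ℝ) (g : ℝ → ℝ) : Prop :=
  ∃ a b c : ℝ, ∀ t, g t = a + b * Real.cos (ω * t) + c * Real.sin (ω * t)

namespace IsSinusoid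

variable {ω : ℝ} {g h : ℝ → ℝ}

theorem const (a : ℝ) : IsSinusoid ω fun _ => a := ⟨a, 0, 0, by simp⟩

theorem add (hg : IsSinusoid ω g) (hh : IsSinusoid ω h) : IsSinusoid ω fun t => g t + h t := by
  obtain ⟨a, b, c, hg⟩ := hg
  obtain ⟨a', b', c', hh⟩ := hh
  exact ⟨a + a', b + b', c + c', fun t => by simp only [hg, hh]; ring⟩

theorem const_mul (r : ℝ) (hg : IsSinusoid ω g) : IsSinusoid ω fun t => r * g t := by
  obtain ⟨a, b, c, hg⟩ := hg
  exact ⟨r * a, r * b, r * c, fun t => by simp only [hg]; ring⟩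

theorem sum {ι : Type*} (s : Finset ι) {g : ι → ℝ → ℝ} (hg : ∀ i ∈ s, IsSinusoid ω (g i)) :
    IsSinusoid ω fun t => ∑ i ∈ s, g i t := by
  classical
  induction s using Finset.induction_on with
  | empty => simpa using const (ω := ω) 0
  | insert i s hi ih =>
    simp only [Finset.sum_insert hi]
    exact (hg i (Finset.mem_insert_self _ _)).add
      (ih fun k hk => hg k (Finset.mem_insert_of_mem hk))

/-- Parameter-shift rule: a shift by a quarter period exchanges sine and cosine up to sign.
Continuity and boundedness of the derivative then follow from those of `g`. -/
theorem deriv_eq_shift (hg : IsSinusoid ω g) (hω : ω ≠ 0) (t : ℝ) :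
    deriv g t = ω / 2 * (g (t + Real.pi / (2 * ω)) - g (t - Real.pi / (2 * ω))) := by
  obtain ⟨a, b, c, hg⟩ := hg
  obtain rfl : g = fun t => a + b * Real.cos (ω * t) + c * Real.sin (ω * t) := funext hg
  have h1 : ω * (t + Real.pi / (2 * ω)) = ω * t + Real.pi / 2 := by field_simp
  have h2 : ω * (t - Real.pi / (2 * ω)) = ω * t - Real.pi / 2 := by field_simp
  rw [deriv_sinusoid]
  simp only [h1, h2, Real.cos_add_pi_div_two, Real.sin_add_pi_div_two, Real.cos_sub_pi_div_two,
    Real.sin_sub_pi_div_two]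
  ring

end IsSinusoid

theorem integral_cos_nat_mul (n : ℕ) (hn : n ≠ 0) :
    ∫ t in (0 : ℝ)..(2 * Real.pi), Real.cos (n * t) = 0 := by
  have hn' : (n : ℝ) ≠ 0 := by exact_mod_cast hn
  rw [intervalIntegral.integral_comp_mul_left (fun t => Real.cos t) hn', integral_cos]
  have : Real.sin (n * (2 * Real.pi)) = 0 := by
    have := Real.sin_nat_mul_pi (n * 2)
    rw [← this]; push_cast; ring_nf
  simp [this]

theorem integral_sin_nat_mul (n : ℕ) (hn : n ≠ 0) :
    ∫ t in (0 : ℝ)..(2 * Real.pi), Real.sin (n * t) = 0 := by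
  have hn' : (n : ℝ) ≠ 0 := by exact_mod_cast hn
  rw [intervalIntegral.integral_comp_mul_left (fun t => Real.sin t) hn', integral_sin]
  have : Real.cos (n * (2 * Real.pi)) = 1 := Real.cos_nat_mul_two_pi n
  simp [this]

theorem integral_sinusoid (n : ℕ) (hn : n ≠ 0) (a b c : ℝ) :
    ∫ t, (a + b * Real.cos (n * t) + c * Real.sin (n * t)) ∂angleLaw = a := by
  have hpi := Real.pi_pos
  rw [integral_angleLaw, intervalIntegral.integral_add, intervalIntegral.integral_add,
    intervalIntegral.integral_const_mul, intervalIntegral.integral_const_mul,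
    integral_cos_nat_mul n hn, integral_sin_nat_mul n hn, intervalIntegral.integral_const]
  · simp only [sub_zero, smul_eq_mul, mul_zero, add_zero]
    field_simp
  all_goals exact Continuous.intervalIntegrable (by fun_prop) _ _

theorem integral_sinusoid_sq (n : ℕ) (hn : n ≠ 0) (a b c : ℝ) :
    ∫ t, (a + b * Real.cos (n * t) + c * Real.sin (n * t)) ^ 2 ∂angleLaw =
      a ^ 2 + (b ^ 2 + c ^ 2) / 2 := by
  -- The double-angle formulas split the square into sinusoids of frequencies `n` and `2 n`, of
  -- which only the constant terms survive integration.
  have h : ∀ t : ℝ, (a + b * Real.cos (n * t) + c * Real.sin (n * t)) ^ 2 =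
      (((a ^ 2 + (b ^ 2 + c ^ 2) / 2) + (2 * a * b) * Real.cos (n * t) +
        (2 * a * c) * Real.sin (n * t))) + (0 + ((b ^ 2 - c ^ 2) / 2) * Real.cos ((2 * n : ℕ) * t)
          + (b * c) * Real.sin ((2 * n : ℕ) * t)) := by
    intro t
    have h2 : ((2 * n : ℕ) : ℝ) * t = 2 * (n * t) := by push_cast; ring
    rw [h2, Real.cos_two_mul, Real.sin_two_mul]
    have := Real.sin_sq_add_cos_sq (n * t)
    have hs : Real.sin (n * t) ^ 2 = 1 - Real.cos (n * t) ^ 2 := by linarith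
    ring_nf
    rw [hs]; ring
  have hi : ∀ (m : ℕ) (a b c : ℝ),
      Integrable (fun t : ℝ => a + b * Real.cos (m * t) + c * Real.sin (m * t)) angleLaw := by
    intro m a b c
    refine Integrable.of_bound (C := |a| + |b| + |c|)
      (Continuous.aestronglyMeasurable (by fun_prop)) (Filter.Eventually.of_forall fun t => ?_)
    have h1 : |b * Real.cos (m * t)| ≤ |b| := by
      rw [abs_mul]; exact mul_le_of_le_one_right (abs_nonneg _) (Real.abs_cos_le_one _)
    have h2 : |c * Real.sin (m * t)| ≤ |c| := by
      rw [abs_mul]; exact mul_le_of_le_one_right (abs_nonneg _) (Real.abs_sin_le_one _)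
    exact (abs_add_three _ _ _).trans (by linarith)
  simp_rw [h]
  rw [integral_add (hi _ _ _ _) (hi _ _ _ _), integral_sinusoid n hn,
    integral_sinusoid (2 * n) (by omega)]
  ring

theorem integral_cos_pow_four : ∫ t, Real.cos t ^ 4 ∂angleLaw = 3 / 8 := by
  have h : ∀ t : ℝ, Real.cos t ^ 4 =
      (1 / 2 + 1 / 2 * Real.cos ((2 : ℕ) * t) + 0 * Real.sin ((2 : ℕ) * t)) ^ 2 := by
    intro t
    push_cast
    rw [Real.cos_two_mul]; ring
  simp_rw [h]
  rw [integral_sinusoid_sq 2 two_ne_zero]; norm_num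

theorem integral_sin_pow_four : ∫ t, Real.sin t ^ 4 ∂angleLaw = 3 / 8 := by
  have h : ∀ t : ℝ, Real.sin t ^ 4 =
      (1 / 2 + (-1 / 2) * Real.cos ((2 : ℕ) * t) + 0 * Real.sin ((2 : ℕ) * t)) ^ 2 := by
    intro t
    push_cast
    rw [Real.cos_two_mul, show Real.sin t ^ 4 = (Real.sin t ^ 2) ^ 2 by ring, Real.sin_sq]; ring
  simp_rw [h]
  rw [integral_sinusoid_sq 2 two_ne_zero]; norm_num

/-! ### Partial derivatives of functions that are sinusoidal in one angle -/

section PartialDeriv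

variable {ι : Type} [DecidableEq ι] {i : ι} {n : ℕ} {g : (ι → ℝ) → ℝ}

theorem continuous_deriv_update (hn : n ≠ 0) (hc : Continuous g)
    (hg : ∀ x, IsSinusoid n fun t => g (Function.update x i t)) :
    Continuous fun x => deriv (fun t => g (Function.update x i t)) (x i) := by
  have hn' : (n : ℝ) ≠ 0 := by exact_mod_cast hn
  have h : ∀ x : ι → ℝ, deriv (fun t => g (Function.update x i t)) (x i) = _ :=
    fun x => (hg x).deriv_eq_shift hn' (x i)
  simp_rw [h]
  fun_prop

theorem abs_deriv_update_le (hn : n ≠ 0) {B : ℝ} (hB : ∀ x, |g x| ≤ B)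
    (hg : ∀ x, IsSinusoid n fun t => g (Function.update x i t)) (x : ι → ℝ) :
    |deriv (fun t => g (Function.update x i t)) (x i)| ≤ n * B := by
  have hn' : (n : ℝ) ≠ 0 := by exact_mod_cast hn
  rw [(hg x).deriv_eq_shift hn' (x i), abs_mul, abs_of_nonneg (by positivity)]
  calc _ ≤ (n / 2 : ℝ) * (B + B) := by
        gcongr
        exact (abs_sub _ _).trans (add_le_add (hB _) (hB _))
    _ = n * B := by ring

variable [Fintype ι]

theorem memLp_two_deriv_update (hn : n ≠ 0) (hc : Continuous g) {B : ℝ} (hB : ∀ x, |g x| ≤ B)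
    (hg : ∀ x, IsSinusoid n fun t => g (Function.update x i t)) :
    MemLp (fun x => deriv (fun t => g (Function.update x i t)) (x i)) 2 (anglesLaw ι) :=
  MemLp.of_bound (continuous_deriv_update hn hc hg).aestronglyMeasurable (n * B)
    (Filter.Eventually.of_forall fun x => abs_deriv_update_le hn hB hg x)

theorem integral_deriv_update_eq_zero (hn : n ≠ 0) (hc : Continuous g) {B : ℝ}
    (hB : ∀ x, |g x| ≤ B) (hg : ∀ x, IsSinusoid n fun t => g (Function.update x i t)) :
    ∫ x, deriv (fun t => g (Function.update x i t)) (x i) ∂anglesLaw ι = 0 := by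
  rw [integral_eq_integral_update i _ ((memLp_two_deriv_update hn hc hB hg).integrable one_le_two)]
  refine integral_eq_zero_of_ae (Filter.Eventually.of_forall fun x => ?_)
  obtain ⟨a, b, c, h⟩ := hg x
  simp only [Function.update_idem, Function.update_self, h, deriv_sinusoid, Pi.zero_apply]
  exact integral_sinusoid n hn _ _ _

/-- For fixed other angles the two averages are `n² (b² + c²) / 2` and `n² (a² + (b² + c²) / 2)`;
Fubini does the rest. -/
theorem integral_deriv_update_sq_le (hn : n ≠ 0) (hc : Continuous g) {B : ℝ}
    (hB : ∀ x, |g x| ≤ B) (hg : ∀ x, IsSinusoid n fun t => g (Function.update x i t)) :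
    ∫ x, (deriv (fun t => g (Function.update x i t)) (x i)) ^ 2 ∂anglesLaw ι ≤
      n ^ 2 * ∫ x, g x ^ 2 ∂anglesLaw ι := by
  have hg2 : MemLp g 2 (anglesLaw ι) :=
    MemLp.of_bound hc.aestronglyMeasurable B (Filter.Eventually.of_forall hB)
  have hd2 := memLp_two_deriv_update hn hc hB hg
  have hup := measurePreserving_update (ι := ι) i
  rw [integral_eq_integral_update i _ hd2.integrable_sq,
    integral_eq_integral_update i _ hg2.integrable_sq, ← integral_const_mul]
  refine integral_mono
    ((hup.integrable_comp_of_integrable hd2.integrable_sq).integral_prod_left)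
    (((hup.integrable_comp_of_integrable hg2.integrable_sq).integral_prod_left).const_mul _)
    fun x => ?_
  obtain ⟨a, b, c, h⟩ := hg x
  simp only [Function.update_idem, Function.update_self, h, deriv_sinusoid]
  rw [integral_sinusoid_sq n hn, integral_sinusoid_sq n hn]
  nlinarith [sq_nonneg ((n : ℝ) * a)]

end PartialDeriv

/-! ### Second moments of the Haar measure and of unitary 2-designs -/

/-- Compactness makes every continuous function of a Haar unitary integrable. -/
instance (n : ℕ) : CompactSpace (Matrix.unitaryGroup (Fin n) ℂ) := by
  refine isCompact_iff_compactSpace.1 ?_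
  have hK : IsCompact (Set.univ.pi fun _ : Fin n => Set.univ.pi fun _ : Fin n =>
      Metric.closedBall (0 : ℂ) 1) :=
    isCompact_univ_pi fun _ => isCompact_univ_pi fun _ => isCompact_closedBall _ _
  refine hK.of_isClosed_subset ?_ fun U hU a _ b _ => ?_
  · have : ((Matrix.unitaryGroup (Fin n) ℂ : Submonoid _) : Set (Matrix (Fin n) (Fin n) ℂ)) =
        {U | star U * U = 1} := by
      ext U
      exact Matrix.mem_unitaryGroup_iff'
    rw [this]
    exact isClosed_eq (by fun_prop) continuous_const
  · simpa using entry_norm_bound_of_unitary hU a b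

section Moments

variable {n : ℕ}

theorem sum_normSq_mulVec_of_mem_unitaryGroup {U : Matrix (Fin n) (Fin n) ℂ}
    (hU : U ∈ Matrix.unitaryGroup (Fin n) ℂ) (v : Fin n → ℂ) :
    ∑ a, Complex.normSq ((U *ᵥ v) a) = ∑ a, Complex.normSq (v a) := by
  have h : ∀ w : Fin n → ℂ, ((∑ a, Complex.normSq (w a) : ℝ) : ℂ) = star w ⬝ᵥ w := by
    intro w
    simp [dotProduct, Complex.normSq_eq_conj_mul_self]
  have hU' : Uᴴ * U = 1 := Matrix.mem_unitaryGroup_iff'.1 hU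
  apply Complex.ofReal_injective
  rw [h, h, Matrix.star_mulVec, ← Matrix.dotProduct_mulVec, Matrix.mulVec_mulVec, hU',
    Matrix.one_mulVec]

theorem exists_unitary_column (w : Fin n → ℂ) (hw : ∑ a, Complex.normSq (w a) = 1) (i : Fin n) :
    ∃ P ∈ Matrix.unitaryGroup (Fin n) ℂ, ∀ a, P a i = w a := by
  -- The family is constant because orthonormality is only required at the index `i`; the extension
  -- to a basis replaces the other entries.
  let v : Fin n → EuclideanSpace ℂ (Fin n) := fun _ => WithLp.toLp 2 w
  have hv : Orthonormal ℂ (({i} : Set (Fin n)).domRestrict v) := by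
    constructor
    · rintro ⟨k, hk⟩
      obtain rfl : k = i := hk
      have : ‖v k‖ ^ 2 = 1 := by
        rw [EuclideanSpace.norm_sq_eq, ← hw]
        simp [v, Complex.sq_norm]
      have h1 : ‖v k‖ = 1 := by
        nlinarith [norm_nonneg (v k)]
      exact h1
    · intro k l hkl
      exact absurd (Subsingleton.elim k l) hkl
  obtain ⟨b, hb⟩ := hv.exists_orthonormalBasis_extension_of_card_eq (by simp)
  refine ⟨Matrix.of fun a k => b k a, ?_, fun a => ?_⟩
  · rw [Matrix.mem_unitaryGroup_iff']
    ext k l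
    have := orthonormal_iff_ite.1 b.orthonormal k l
    simp only [PiLp.inner_apply, RCLike.inner_apply] at this
    simp only [Matrix.star_eq_conjTranspose, Matrix.mul_apply, Matrix.conjTranspose_apply,
      Matrix.of_apply, Matrix.one_apply, ← this]
    exact Finset.sum_congr rfl fun a _ => by simp [mul_comm]
  · simp [hb i rfl, v]

variable (ν : Measure (Matrix.unitaryGroup (Fin n) ℂ)) [ν.IsHaarMeasure]
  (φ : Fin n → ℂ)

/-- Left invariance of `ν`, the source of the moment identities below. -/
theorem integral_haar_mulVec_eq (P : Matrix.unitaryGroup (Fin n) ℂ) (F : (Fin n → ℂ) → ℝ) :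
    ∫ V : Matrix.unitaryGroup (Fin n) ℂ, F ((P : Matrix (Fin n) (Fin n) ℂ) *ᵥ
      ((V : Matrix (Fin n) (Fin n) ℂ) *ᵥ φ)) ∂ν =
      ∫ V : Matrix.unitaryGroup (Fin n) ℂ, F ((V : Matrix (Fin n) (Fin n) ℂ) *ᵥ φ) ∂ν := by
  rw [← integral_mul_left_eq_self
    (fun V : Matrix.unitaryGroup (Fin n) ℂ => F ((V : Matrix (Fin n) (Fin n) ℂ) *ᵥ φ)) P]
  simp [Matrix.mulVec_mulVec]

theorem continuous_unitaryGroup_mulVec (a : Fin n) :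
    Continuous fun V : Matrix.unitaryGroup (Fin n) ℂ =>
      ((V : Matrix (Fin n) (Fin n) ℂ) *ᵥ φ) a := by
  have : Continuous fun V : Matrix.unitaryGroup (Fin n) ℂ => (V : Matrix (Fin n) (Fin n) ℂ) *ᵥ φ :=
    Continuous.matrix_mulVec continuous_subtype_val continuous_const
  exact (continuous_apply a).comp this

/-- The fourth moment `E |⟨w, V φ⟩|⁴` only depends on the norm of `w`. -/
theorem integral_haar_normSq_sq (w : Fin n → ℂ) (i : Fin n) :
    ∫ V : Matrix.unitaryGroup (Fin n) ℂ,
        Complex.normSq (star w ⬝ᵥ ((V : Matrix (Fin n) (Fin n) ℂ) *ᵥ φ)) ^ 2 ∂ν =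
      (∑ a, Complex.normSq (w a)) ^ 2 * ∫ V : Matrix.unitaryGroup (Fin n) ℂ,
        Complex.normSq (((V : Matrix (Fin n) (Fin n) ℂ) *ᵥ φ) i) ^ 2 ∂ν := by
  by_cases hw : ∑ a, Complex.normSq (w a) = 0
  · have hw0 : w = 0 := by
      funext a
      have := (Finset.sum_eq_zero_iff_of_nonneg fun a _ => Complex.normSq_nonneg (w a)).1 hw a
        (Finset.mem_univ a)
      simpa using this
    simp [hw0]
  · have hpos : 0 < ∑ a, Complex.normSq (w a) :=
      lt_of_le_of_ne (Finset.sum_nonneg fun a _ => Complex.normSq_nonneg _) (Ne.symm hw)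
    set S := ∑ a, Complex.normSq (w a) with hS
    set r : ℝ := Real.sqrt S with hr
    have hr2 : r * r = S := Real.mul_self_sqrt hpos.le
    have hr0 : (r : ℂ) ≠ 0 := by
      simpa using (Real.sqrt_pos.2 hpos).ne'
    -- With `w / ‖w‖` as column `i` of a unitary `P`, `⟨w, V φ⟩ = ‖w‖ (P* V φ)_i`, and left
    -- invariance removes `P*`.
    obtain ⟨P, hP, hPi⟩ := exists_unitary_column (fun a => (r : ℂ)⁻¹ * w a) (by
      simp only [map_mul, map_inv₀, Complex.normSq_ofReal, ← Finset.mul_sum, ← hS, hr2]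
      field_simp) i
    rw [← integral_haar_mulVec_eq ν φ (star ⟨P, hP⟩) fun u => Complex.normSq (u i) ^ 2,
      ← integral_const_mul]
    refine integral_congr_ae (Filter.Eventually.of_forall fun V => ?_)
    have h : star w ⬝ᵥ ((V : Matrix (Fin n) (Fin n) ℂ) *ᵥ φ) =
        r * (((star ⟨P, hP⟩ : Matrix.unitaryGroup (Fin n) ℂ) : Matrix (Fin n) (Fin n) ℂ) *ᵥ
          ((V : Matrix (Fin n) (Fin n) ℂ) *ᵥ φ)) i := by
      simp only [Matrix.mulVec, dotProduct, Finset.mul_sum]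
      refine Finset.sum_congr rfl fun a _ => ?_
      simp only [Pi.star_apply, Unitary.coe_star, Matrix.star_apply, hPi, star_mul',
        RCLike.star_def, map_inv₀, Complex.conj_ofReal]
      field_simp
    simp only [h, map_mul, Complex.normSq_ofReal, hr2]
    ring

/-- Polarization: the sum of `|x + s y|⁴` over the fourth roots of unity `s` is `4 |x|⁴ + 4 |y|⁴ +
16 |x|² |y|²`. Each of the four terms has mean `4 κ`, the underlying vector having squared norm `2`,
so the mixed moment is `(16 κ - 8 κ) / 16`. -/
theorem integral_haar_normSq_mul {a b : Fin n} (hab : a ≠ b)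
    (i : Fin n) :
    ∫ V : Matrix.unitaryGroup (Fin n) ℂ,
        Complex.normSq (((V : Matrix (Fin n) (Fin n) ℂ) *ᵥ φ) a) *
          Complex.normSq (((V : Matrix (Fin n) (Fin n) ℂ) *ᵥ φ) b) ∂ν =
      (∫ V : Matrix.unitaryGroup (Fin n) ℂ,
        Complex.normSq (((V : Matrix (Fin n) (Fin n) ℂ) *ᵥ φ) i) ^ 2 ∂ν) / 2 := by
  set κ := ∫ V : Matrix.unitaryGroup (Fin n) ℂ,
    Complex.normSq (((V : Matrix (Fin n) (Fin n) ℂ) *ᵥ φ) i) ^ 2 ∂ν with hκ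
  have hcont := continuous_unitaryGroup_mulVec φ
  have hint : ∀ F : Matrix.unitaryGroup (Fin n) ℂ → ℝ, Continuous F → Integrable F ν :=
    fun F hF => hF.integrable_of_hasCompactSupport (HasCompactSupport.of_compactSpace F)
  have hw : ∀ s : ℂ, Complex.normSq s = 1 → ∫ V : Matrix.unitaryGroup (Fin n) ℂ,
      Complex.normSq (((V : Matrix (Fin n) (Fin n) ℂ) *ᵥ φ) a +
        s * ((V : Matrix (Fin n) (Fin n) ℂ) *ᵥ φ) b) ^ 2 ∂ν = 4 * κ := by
    intro s hs
    have := integral_haar_normSq_sq ν φ (Pi.single a 1 + Pi.single b (star s)) i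
    have h2 : ∑ k, Complex.normSq ((Pi.single a 1 + Pi.single b (star s) : Fin n → ℂ) k) = 2 := by
      rw [Finset.sum_eq_add a b hab]
      · simp [hab, hab.symm, hs, Complex.normSq_conj]; norm_num
      · intro k _ hk; simp [hk.1, hk.2]
      · simp
      · simp
    rw [h2] at this
    rw [← hκ] at this
    rw [show (4 : ℝ) * κ = 2 ^ 2 * κ by ring, ← this]
    refine integral_congr_ae (Filter.Eventually.of_forall fun V => ?_)
    simp [star_add, add_dotProduct]
  have ha : ∀ c, ∫ V : Matrix.unitaryGroup (Fin n) ℂ,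
      Complex.normSq (((V : Matrix (Fin n) (Fin n) ℂ) *ᵥ φ) c) ^ 2 ∂ν = κ := by
    intro c
    have := integral_haar_normSq_sq ν φ (Pi.single c 1) i
    rw [← hκ] at this
    simpa [← Pi.single_star, Pi.single_apply, apply_ite Complex.normSq] using this
  have hid : ∀ x y : ℂ, Complex.normSq (x + 1 * y) ^ 2 + Complex.normSq (x + -1 * y) ^ 2 +
      Complex.normSq (x + Complex.I * y) ^ 2 + Complex.normSq (x + -Complex.I * y) ^ 2 =
      4 * Complex.normSq x ^ 2 + 4 * Complex.normSq y ^ 2 +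
        16 * (Complex.normSq x * Complex.normSq y) := by
    intro x y
    simp only [Complex.normSq_apply, Complex.add_re, Complex.add_im, Complex.mul_re,
      Complex.mul_im, Complex.I_re, Complex.I_im, Complex.neg_re, Complex.neg_im, Complex.one_re,
      Complex.one_im]
    ring
  have hc : ∀ s : ℂ, Integrable (fun V : Matrix.unitaryGroup (Fin n) ℂ =>
      Complex.normSq (((V : Matrix (Fin n) (Fin n) ℂ) *ᵥ φ) a +
        s * ((V : Matrix (Fin n) (Fin n) ℂ) *ᵥ φ) b) ^ 2) ν := fun s =>
    hint _ ((Complex.continuous_normSq.comp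
      ((hcont a).add (continuous_const.mul (hcont b)))).pow 2)
  have hd : ∀ c, Integrable (fun V : Matrix.unitaryGroup (Fin n) ℂ =>
      Complex.normSq (((V : Matrix (Fin n) (Fin n) ℂ) *ᵥ φ) c) ^ 2) ν := fun c =>
    hint _ ((Complex.continuous_normSq.comp (hcont c)).pow 2)
  have hm : Integrable (fun V : Matrix.unitaryGroup (Fin n) ℂ =>
      Complex.normSq (((V : Matrix (Fin n) (Fin n) ℂ) *ᵥ φ) a) *
        Complex.normSq (((V : Matrix (Fin n) (Fin n) ℂ) *ᵥ φ) b)) ν :=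
    hint _ ((Complex.continuous_normSq.comp (hcont a)).mul
      (Complex.continuous_normSq.comp (hcont b)))
  have key := integral_congr_ae (μ := ν) (Filter.Eventually.of_forall
    fun V : Matrix.unitaryGroup (Fin n) ℂ => hid (((V : Matrix (Fin n) (Fin n) ℂ) *ᵥ φ) a)
      (((V : Matrix (Fin n) (Fin n) ℂ) *ᵥ φ) b))
  rw [integral_add (((hc 1).fun_add (hc (-1))).fun_add (hc Complex.I)) (hc (-Complex.I)),
    integral_add ((hc 1).fun_add (hc (-1))) (hc Complex.I), integral_add (hc 1) (hc (-1)),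
    integral_add (((hd a).const_mul 4).fun_add ((hd b).const_mul 4)) (hm.const_mul 16),
    integral_add ((hd a).const_mul 4) ((hd b).const_mul 4), integral_const_mul, integral_const_mul,
    integral_const_mul, hw 1 (by simp), hw (-1) (by simp), hw Complex.I (by simp),
    hw (-Complex.I) (by simp), ha, ha] at key
  linarith

variable [IsProbabilityMeasure ν]

/-- Expanding the square leaves one unknown, the fourth moment `κ` of a coordinate. For `r = 1` the
sum is `‖V φ‖² = 1`, which forces `κ / 2 = 1 / (n (n + 1))`. -/
theorem integral_haar_sum_normSq_sq (hφ : ∑ a, Complex.normSq (φ a) = 1) (r : Fin n → ℝ) :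
    ∫ V : Matrix.unitaryGroup (Fin n) ℂ,
      (∑ a, r a * Complex.normSq (((V : Matrix (Fin n) (Fin n) ℂ) *ᵥ φ) a)) ^ 2 ∂ν =
      (∑ a, r a ^ 2 + (∑ a, r a) ^ 2) / (n * (n + 1)) := by
  classical
  have hn : n ≠ 0 := by
    rintro rfl
    simp at hφ
  let i : Fin n := ⟨0, Nat.pos_of_ne_zero hn⟩
  set κ := ∫ V : Matrix.unitaryGroup (Fin n) ℂ,
    Complex.normSq (((V : Matrix (Fin n) (Fin n) ℂ) *ᵥ φ) i) ^ 2 ∂ν with hκ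
  have hcont := continuous_unitaryGroup_mulVec φ
  have hpair : ∀ a b, ∫ V : Matrix.unitaryGroup (Fin n) ℂ,
      Complex.normSq (((V : Matrix (Fin n) (Fin n) ℂ) *ᵥ φ) a) *
        Complex.normSq (((V : Matrix (Fin n) (Fin n) ℂ) *ᵥ φ) b) ∂ν =
      κ / 2 + if a = b then κ / 2 else 0 := by
    intro a b
    by_cases hab : a = b
    · subst hab
      have := integral_haar_normSq_sq ν φ (Pi.single a 1) i
      simp only [if_true, add_halves, ← sq]
      simpa [Pi.single_apply, apply_ite Complex.normSq] using this
    · rw [integral_haar_normSq_mul ν φ hab i]; simp [hab, hκ]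
  have hgen : ∀ r : Fin n → ℝ, ∫ V : Matrix.unitaryGroup (Fin n) ℂ,
      (∑ a, r a * Complex.normSq (((V : Matrix (Fin n) (Fin n) ℂ) *ᵥ φ) a)) ^ 2 ∂ν =
      κ / 2 * (∑ a, r a ^ 2 + (∑ a, r a) ^ 2) := by
    intro r
    have hexp : ∀ V : Matrix.unitaryGroup (Fin n) ℂ,
        (∑ a, r a * Complex.normSq (((V : Matrix (Fin n) (Fin n) ℂ) *ᵥ φ) a)) ^ 2 =
        ∑ a, ∑ b, (r a * r b) * (Complex.normSq (((V : Matrix (Fin n) (Fin n) ℂ) *ᵥ φ) a) *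
          Complex.normSq (((V : Matrix (Fin n) (Fin n) ℂ) *ᵥ φ) b)) := by
      intro V
      rw [sq, Finset.sum_mul_sum]
      exact Finset.sum_congr rfl fun a _ => Finset.sum_congr rfl fun b _ => by ring
    have hint : ∀ a b, Integrable (fun V : Matrix.unitaryGroup (Fin n) ℂ =>
        (r a * r b) * (Complex.normSq (((V : Matrix (Fin n) (Fin n) ℂ) *ᵥ φ) a) *
          Complex.normSq (((V : Matrix (Fin n) (Fin n) ℂ) *ᵥ φ) b))) ν := fun a b =>
      (((Complex.continuous_normSq.comp (hcont a)).mul (Complex.continuous_normSq.comp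
        (hcont b))).integrable_of_hasCompactSupport (HasCompactSupport.of_compactSpace _)).const_mul _
    simp_rw [hexp]
    rw [integral_finsetSum _ fun a _ => integrable_finsetSum _ fun b _ => hint a b]
    simp_rw [fun a => integral_finsetSum Finset.univ fun b _ => hint a b, integral_const_mul, hpair,
      mul_add, Finset.sum_add_distrib, mul_ite, mul_zero, Finset.sum_ite_eq, Finset.mem_univ,
      if_true, sq, Finset.sum_mul_sum, Finset.mul_sum]
    rw [add_comm]
    congr 1
    · exact Finset.sum_congr rfl fun a _ => by ring
    · exact Finset.sum_congr rfl fun a _ => Finset.sum_congr rfl fun b _ => by ring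
  have hone := hgen fun _ => 1
  have hsum : ∀ V : Matrix.unitaryGroup (Fin n) ℂ,
      ∑ a, Complex.normSq (((V : Matrix (Fin n) (Fin n) ℂ) *ᵥ φ) a) = 1 := fun V => by
    rw [sum_normSq_mulVec_of_mem_unitaryGroup V.2, hφ]
  simp only [one_mul, hsum, one_pow, integral_const, probReal_univ, smul_eq_mul,
    Finset.sum_const, Finset.card_univ, Fintype.card_fin, nsmul_eq_mul, mul_one] at hone
  have hn' : (n : ℝ) ≠ 0 := by exact_mod_cast hn
  have hn1 : (n : ℝ) + 1 ≠ 0 := by positivity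
  have hκ2 : κ / 2 = 1 / (n * (n + 1)) := by
    field_simp
    linarith
  rw [hgen, hκ2]; ring

/-- Left invariance absorbs an eigenbasis of `M` and leaves the eigenvalues as coefficients. They
sum to the trace, which is zero, and their squares sum to `tr (M²)`. -/
theorem integral_haar_quadratic_sq (hφ : ∑ a, Complex.normSq (φ a) = 1)
    {M : Matrix (Fin n) (Fin n) ℂ} (hM : M.IsHermitian) (hM0 : M.trace = 0) :
    ∫ V : Matrix.unitaryGroup (Fin n) ℂ,
      (star ((V : Matrix (Fin n) (Fin n) ℂ) *ᵥ φ) ⬝ᵥ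
        (M *ᵥ ((V : Matrix (Fin n) (Fin n) ℂ) *ᵥ φ))).re ^ 2 ∂ν =
      (∑ a, ∑ b, Complex.normSq (M a b)) / (n * (n + 1)) := by
  set P := hM.eigenvectorUnitary with hP
  have hspec : M = (P : Matrix (Fin n) (Fin n) ℂ) *
      Matrix.diagonal (fun k => (hM.eigenvalues k : ℂ)) * (P : Matrix (Fin n) (Fin n) ℂ)ᴴ := by
    have := hM.spectral_theorem
    rw [Unitary.conjStarAlgAut_apply] at this
    exact this
  have hPP : (P : Matrix (Fin n) (Fin n) ℂ)ᴴ * (P : Matrix (Fin n) (Fin n) ℂ) = 1 :=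
    Matrix.mem_unitaryGroup_iff'.1 P.2
  have hquad : ∀ u : Fin n → ℂ, (star u ⬝ᵥ (M *ᵥ u)).re = ∑ k, hM.eigenvalues k *
      Complex.normSq ((((star P : Matrix.unitaryGroup (Fin n) ℂ) : Matrix (Fin n) (Fin n) ℂ) *ᵥ u)
        k) := by
    intro u
    have h1 : star u ⬝ᵥ (M *ᵥ u) = star ((P : Matrix (Fin n) (Fin n) ℂ)ᴴ *ᵥ u) ⬝ᵥ
        (Matrix.diagonal (fun k => (hM.eigenvalues k : ℂ)) *ᵥ
          ((P : Matrix (Fin n) (Fin n) ℂ)ᴴ *ᵥ u)) := by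
      conv_lhs => rw [hspec]
      rw [Matrix.star_mulVec, Matrix.conjTranspose_conjTranspose, ← Matrix.dotProduct_mulVec,
        Matrix.mulVec_mulVec, Matrix.mulVec_mulVec, Matrix.mul_assoc]
    rw [h1, dotProduct, Complex.re_sum]
    refine Finset.sum_congr rfl fun k _ => ?_
    rw [Matrix.mulVec_diagonal, Unitary.coe_star, Matrix.star_eq_conjTranspose, Pi.star_apply]
    simp only [Complex.normSq_apply, RCLike.star_def, Complex.mul_re, Complex.mul_im,
      Complex.conj_re, Complex.conj_im, Complex.ofReal_re, Complex.ofReal_im]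
    ring
  have htr : ∑ k, hM.eigenvalues k = 0 := by
    have := hM.trace_eq_sum_eigenvalues
    rw [hM0] at this
    apply Complex.ofReal_injective
    simpa using this.symm
  have hsq : ∑ k, hM.eigenvalues k ^ 2 = ∑ a, ∑ b, Complex.normSq (M a b) := by
    have h1 : (M * M).trace = ((∑ a, ∑ b, Complex.normSq (M a b) : ℝ) : ℂ) := by
      simp only [Matrix.trace, Matrix.diag_apply, Matrix.mul_apply, Complex.ofReal_sum]
      refine Finset.sum_congr rfl fun a _ => Finset.sum_congr rfl fun b _ => ?_
      rw [← hM.apply a b, Complex.normSq_eq_conj_mul_self]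
      simp [mul_comm]
    have h2 : (M * M).trace = ((∑ k, hM.eigenvalues k ^ 2 : ℝ) : ℂ) := by
      have : M * M = (P : Matrix (Fin n) (Fin n) ℂ) *
          (Matrix.diagonal (fun k => (hM.eigenvalues k : ℂ)) *
            Matrix.diagonal (fun k => (hM.eigenvalues k : ℂ)) *
              (P : Matrix (Fin n) (Fin n) ℂ)ᴴ) := by
        conv_lhs => rw [hspec]
        simp only [Matrix.mul_assoc]
        rw [← Matrix.mul_assoc _ (P : Matrix (Fin n) (Fin n) ℂ), hPP, Matrix.one_mul]
      rw [this, Matrix.trace_mul_comm, Matrix.mul_assoc, hPP, Matrix.mul_one,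
        Matrix.diagonal_mul_diagonal, Matrix.trace_diagonal]
      simp [sq]
    exact Complex.ofReal_injective (h2.symm.trans h1)
  simp_rw [hquad]
  rw [integral_haar_mulVec_eq ν φ (star P) fun u =>
    (∑ k, hM.eigenvalues k * Complex.normSq (u k)) ^ 2, integral_haar_sum_normSq_sq ν φ hφ, hsq, htr]
  ring

end Moments

theorem im_quadratic_eq_zero {n : ℕ} {M : Matrix (Fin n) (Fin n) ℂ} (hM : M.IsHermitian)
    (u : Fin n → ℂ) : (star u ⬝ᵥ (M *ᵥ u)).im = 0 := by
  have h : star (star u ⬝ᵥ (M *ᵥ u)) = star u ⬝ᵥ (M *ᵥ u) := by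
    rw [← Matrix.star_dotProduct_star, star_star, Matrix.star_mulVec, hM.eq, Matrix.dotProduct_mulVec,
      dotProduct_comm]
  have := congrArg Complex.im h
  simp only [RCLike.star_def, Complex.conj_im] at this
  linarith

/-- The second moment of `⟨φ|U† M U|φ⟩` for a 2-design `U` and a traceless observable `M`. -/
theorem integral_twoDesign_quadratic_sq {Ω : Type} [MeasurableSpace Ω] (P : Measure Ω)
    [IsProbabilityMeasure P] {n : ℕ} {U : Ω → Matrix (Fin n) (Fin n) ℂ} (hU : IsTwoDesign P U)
    (hUm : ∀ a b, Measurable fun ω => U ω a b) (hUu : ∀ ω, U ω ∈ Matrix.unitaryGroup (Fin n) ℂ)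
    {φ : Fin n → ℂ} (hφ : ∑ a, Complex.normSq (φ a) = 1)
    {M : Matrix (Fin n) (Fin n) ℂ} (hM : M.IsHermitian) (hM0 : M.trace = 0) :
    ∫ ω, (star (U ω *ᵥ φ) ⬝ᵥ (M *ᵥ (U ω *ᵥ φ))).re ^ 2 ∂P =
      (∑ a, ∑ b, Complex.normSq (M a b)) / (n * (n + 1)) := by
  obtain ⟨ν, hν, hν1, hmom⟩ := hU
  rw [← integral_haar_quadratic_sq ν φ hφ hM hM0]
  let T := (Fin n × Fin n) × (Fin n × Fin n)
  let c : T → ℂ := fun t => star (φ t.2.2) * M t.1.1 t.1.2 * φ t.2.1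
  -- The square is a polynomial of degree `(2, 2)` in the entries of `W` and their conjugates, so
  -- the design property applies term by term.
  have hq : ∀ W : Matrix (Fin n) (Fin n) ℂ,
      (((star (W *ᵥ φ) ⬝ᵥ (M *ᵥ (W *ᵥ φ))).re ^ 2 : ℝ) : ℂ) =
      ∑ t : T, ∑ s : T, (c t * c s) * (W t.1.2 t.2.1 * W s.1.2 s.2.1 * star (W t.1.1 t.2.2) *
        star (W s.1.1 s.2.2)) := by
    intro W
    have h1 : star (W *ᵥ φ) ⬝ᵥ (M *ᵥ (W *ᵥ φ)) =
        ∑ t : T, c t * (W t.1.2 t.2.1 * star (W t.1.1 t.2.2)) := by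
      simp only [T, c, Fintype.sum_prod_type, dotProduct, Matrix.mulVec, Pi.star_apply, star_sum,
        Finset.sum_mul, Finset.mul_sum, star_mul']
      refine Finset.sum_congr rfl fun a _ => ?_
      refine Finset.sum_congr rfl fun b _ => ?_
      refine Finset.sum_congr rfl fun j _ => ?_
      refine Finset.sum_congr rfl fun i _ => ?_
      ring
    have h2 : (((star (W *ᵥ φ) ⬝ᵥ (M *ᵥ (W *ᵥ φ))).re : ℝ) : ℂ) =
        star (W *ᵥ φ) ⬝ᵥ (M *ᵥ (W *ᵥ φ)) :=
      Complex.ext rfl ((im_quadratic_eq_zero hM _).symm)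
    rw [Complex.ofReal_pow, h2, h1, sq, Finset.sum_mul_sum]
    refine Finset.sum_congr rfl fun t _ => Finset.sum_congr rfl fun s _ => ?_
    ring
  have hbound : ∀ W ∈ Matrix.unitaryGroup (Fin n) ℂ, ∀ a₁ b₁ a₂ b₂ a₃ b₃ a₄ b₄ : Fin n,
      ‖W a₁ b₁ * W a₂ b₂ * star (W a₃ b₃) * star (W a₄ b₄)‖ ≤ 1 := by
    intro W hW a₁ b₁ a₂ b₂ a₃ b₃ a₄ b₄
    have h := entry_norm_bound_of_unitary hW
    simp only [norm_mul, norm_star]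
    exact mul_le_one₀ (mul_le_one₀ (mul_le_one₀ (h _ _) (norm_nonneg _) (h _ _))
      (norm_nonneg _) (h _ _)) (norm_nonneg _) (h _ _)
  have hiP : ∀ a₁ b₁ a₂ b₂ a₃ b₃ a₄ b₄ : Fin n, Integrable
      (fun ω => U ω a₁ b₁ * U ω a₂ b₂ * star (U ω a₃ b₃) * star (U ω a₄ b₄)) P := by
    intro a₁ b₁ a₂ b₂ a₃ b₃ a₄ b₄
    refine Integrable.of_bound (C := 1) ?_
      (Filter.Eventually.of_forall fun ω => hbound _ (hUu ω) _ _ _ _ _ _ _ _)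
    have := continuous_star (R := ℂ)
    exact ((((hUm _ _).mul (hUm _ _)).mul (this.measurable.comp (hUm _ _))).mul
      (this.measurable.comp (hUm _ _))).aestronglyMeasurable
  have hcV : ∀ a b : Fin n, Continuous fun V : Matrix.unitaryGroup (Fin n) ℂ =>
      (V : Matrix (Fin n) (Fin n) ℂ) a b := fun a b =>
    (continuous_apply_apply a b).comp continuous_subtype_val
  have hiν : ∀ a₁ b₁ a₂ b₂ a₃ b₃ a₄ b₄ : Fin n, Integrable
      (fun V : Matrix.unitaryGroup (Fin n) ℂ => (V : Matrix (Fin n) (Fin n) ℂ) a₁ b₁ *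
        (V : Matrix (Fin n) (Fin n) ℂ) a₂ b₂ * star ((V : Matrix (Fin n) (Fin n) ℂ) a₃ b₃) *
          star ((V : Matrix (Fin n) (Fin n) ℂ) a₄ b₄)) ν := by
    intro a₁ b₁ a₂ b₂ a₃ b₃ a₄ b₄
    have := continuous_star (R := ℂ)
    refine Continuous.integrable_of_hasCompactSupport
      ((((hcV _ _).mul (hcV _ _)).mul (this.comp (hcV _ _))).mul (this.comp (hcV _ _)))
      (HasCompactSupport.of_compactSpace _)
  apply Complex.ofReal_injective
  rw [← integral_complex_ofReal, ← integral_complex_ofReal]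
  simp_rw [hq]
  rw [integral_finsetSum _ fun t _ => integrable_finsetSum _ fun s _ => (hiP _ _ _ _ _ _ _ _).const_mul _,
    integral_finsetSum _ fun t _ => integrable_finsetSum _ fun s _ => (hiν _ _ _ _ _ _ _ _).const_mul _]
  refine Finset.sum_congr rfl fun t _ => ?_
  rw [integral_finsetSum _ fun s _ => (hiP _ _ _ _ _ _ _ _).const_mul _,
    integral_finsetSum _ fun s _ => (hiν _ _ _ _ _ _ _ _).const_mul _]
  refine Finset.sum_congr rfl fun s _ => ?_
  rw [integral_const_mul, integral_const_mul, hmom]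

/-! ### The amplitudes of the coefficient layer -/

section Amplitude

variable {L : ℕ}

/-- The factor of the amplitude of the leaf `j` at depth `k` of the tree. -/
noncomputable def amplitudeFactor (L : ℕ) (α : Fin (L - 1) → ℝ) (j : Fin L) (k : ℕ) : ℝ :=
  if h : 2 ^ k + (j : ℕ) % 2 ^ k < L then
    if (j : ℕ).testBit k then
      Real.sin (α ⟨2 ^ k + (j : ℕ) % 2 ^ k - 1,
        Nat.sub_lt_sub_right (Nat.le_add_right_of_le Nat.one_le_two_pow) h⟩)
    else
      Real.cos (α ⟨2 ^ k + (j : ℕ) % 2 ^ k - 1,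
        Nat.sub_lt_sub_right (Nat.le_add_right_of_le Nat.one_le_two_pow) h⟩)
  else 1

theorem amplitude_eq_prod (α : Fin (L - 1) → ℝ) (j : Fin L) :
    amplitude L α j = ∏ k ∈ Finset.range L, amplitudeFactor L α j k := rfl

theorem abs_amplitudeFactor_le_one (α : Fin (L - 1) → ℝ) (j : Fin L) (k : ℕ) :
    |amplitudeFactor L α j k| ≤ 1 := by
  unfold amplitudeFactor
  split_ifs
  · exact Real.abs_sin_le_one _
  · exact Real.abs_cos_le_one _
  · simp

theorem abs_amplitude_le_one (α : Fin (L - 1) → ℝ) (j : Fin L) : |amplitude L α j| ≤ 1 := by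
  rw [amplitude_eq_prod, Finset.abs_prod]
  exact Finset.prod_le_one (fun _ _ => abs_nonneg _) fun k _ => abs_amplitudeFactor_le_one α j k

theorem differentiable_amplitude (j : Fin L) :
    Differentiable ℝ fun α : Fin (L - 1) → ℝ => amplitude L α j := by
  simp only [amplitude_eq_prod]
  have h : ∀ k, Differentiable ℝ fun α : Fin (L - 1) → ℝ => amplitudeFactor L α j k := by
    intro k
    unfold amplitudeFactor
    split_ifs <;> fun_prop
  exact fun α => (HasFDerivAt.finsetProd fun k _ => (h k α).hasFDerivAt).differentiableAt

/-- The node at depth `k` lies in `[2 ^ k, 2 ^ (k + 1))`, so its binary logarithm recovers `k`.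
Hence no path meets the same angle twice. -/
theorem node_injective {j k k' : ℕ} (h : 2 ^ k + j % 2 ^ k - 1 = 2 ^ k' + j % 2 ^ k' - 1) :
    k = k' := by
  have hlog : ∀ m, Nat.log 2 (2 ^ m + j % 2 ^ m) = m := fun m =>
    Nat.log_eq_of_pow_le_of_lt_pow (by omega) (by
      have := Nat.mod_lt j (Nat.two_pow_pos m)
      rw [pow_succ]; omega)
  have h1 := Nat.two_pow_pos k
  have h2 := Nat.two_pow_pos k'
  rw [← hlog k, ← hlog k', show 2 ^ k + j % 2 ^ k = 2 ^ k' + j % 2 ^ k' by omega]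

theorem amplitudeFactor_update_of_ne (α : Fin (L - 1) → ℝ) (j : Fin L) {k : ℕ} {i : Fin (L - 1)}
    (h : 2 ^ k + (j : ℕ) % 2 ^ k - 1 ≠ i) (t : ℝ) :
    amplitudeFactor L (Function.update α i t) j k = amplitudeFactor L α j k := by
  unfold amplitudeFactor
  split_ifs with h1 h2
  · rw [Function.update_of_ne]
    exact fun h' => h (congrArg Fin.val h')
  · rw [Function.update_of_ne]
    exact fun h' => h (congrArg Fin.val h')
  · rfl

/-- At most one factor on the path contains the angle `i`, and `cos²`, `sin²` are sinusoids of
frequency two. -/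
theorem isSinusoid_amplitude_sq (α : Fin (L - 1) → ℝ) (j : Fin L) (i : Fin (L - 1)) :
    IsSinusoid (2 : ℕ) fun t => amplitude L (Function.update α i t) j ^ 2 := by
  simp only [amplitude_eq_prod]
  by_cases h : ∃ k ∈ Finset.range L, 2 ^ k + (j : ℕ) % 2 ^ k - 1 = i
  · obtain ⟨k, hk, hki⟩ := h
    have hlt : 2 ^ k + (j : ℕ) % 2 ^ k < L := by
      have := i.2
      omega
    have hrest : ∀ t, ∏ m ∈ (Finset.range L).erase k,
        amplitudeFactor L (Function.update α i t) j m =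
          ∏ m ∈ (Finset.range L).erase k, amplitudeFactor L α j m := fun t =>
      Finset.prod_congr rfl fun m hm => amplitudeFactor_update_of_ne α j
        (fun h' => (Finset.ne_of_mem_erase hm) (node_injective (h'.trans hki.symm))) t
    simp only [← Finset.mul_prod_erase _ _ hk, hrest, mul_pow]
    set r := (∏ m ∈ (Finset.range L).erase k, amplitudeFactor L α j m) ^ 2
    simp only [mul_comm _ r]
    refine IsSinusoid.const_mul r ?_
    have hi : (⟨2 ^ k + (j : ℕ) % 2 ^ k - 1,
        Nat.sub_lt_sub_right (Nat.le_add_right_of_le Nat.one_le_two_pow) hlt⟩ : Fin (L - 1)) = i :=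
      Fin.ext hki
    simp only [amplitudeFactor, dif_pos hlt, hi, Function.update_self]
    split_ifs
    · exact ⟨1 / 2, -1 / 2, 0, fun t => by push_cast; rw [Real.cos_two_mul, Real.sin_sq]; ring⟩
    · exact ⟨1 / 2, 1 / 2, 0, fun t => by push_cast; rw [Real.cos_two_mul]; ring⟩
  · push Not at h
    have : ∀ t, ∏ k ∈ Finset.range L, amplitudeFactor L (Function.update α i t) j k =
        ∏ k ∈ Finset.range L, amplitudeFactor L α j k := fun t =>
      Finset.prod_congr rfl fun m hm => amplitudeFactor_update_of_ne α j (h m hm) t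
    simp only [this]
    exact IsSinusoid.const _

/-- Every leaf has depth at least `Nat.log 2 L`. -/
theorem integral_amplitude_pow_four_le (j : Fin L) :
    ∫ α, amplitude L α j ^ 4 ∂anglesLaw (Fin (L - 1)) ≤ (3 / 8) ^ Nat.log 2 L := by
  set T := Nat.log 2 L with hT
  have hL : L ≠ 0 := by have := j.2; omega
  have hTL : 2 ^ T ≤ L := Nat.pow_log_le_self 2 hL
  -- At depth `k < T` the node number is below `2 ^ (k + 1) ≤ 2 ^ T ≤ L`, so the node branches.
  have hlt : ∀ k < T, 2 ^ k + (j : ℕ) % 2 ^ k < L := fun k hk => by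
    have h1 := Nat.mod_lt (j : ℕ) (Nat.two_pow_pos k)
    have h2 : 2 ^ (k + 1) ≤ 2 ^ T := Nat.pow_le_pow_right two_pos hk
    rw [pow_succ] at h2
    omega
  let e : Fin T → Fin (L - 1) := fun k => ⟨2 ^ (k : ℕ) + (j : ℕ) % 2 ^ (k : ℕ) - 1,
    Nat.sub_lt_sub_right (Nat.le_add_right_of_le Nat.one_le_two_pow) (hlt k k.2)⟩
  have he : Function.Injective e := fun k k' h =>
    Fin.ext (node_injective (congrArg Fin.val h))
  let g : Fin T → ℝ → ℝ := fun k t =>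
    if (j : ℕ).testBit k then Real.sin t ^ 4 else Real.cos t ^ 4
  have hg : ∀ k, Continuous (g k) := fun k => by
    simp only [g]; split_ifs <;> fun_prop
  -- Factors at depth `T` or more are dropped, being at most one in absolute value. The others have
  -- distinct angles and integrate independently.
  have hle : ∀ α, amplitude L α j ^ 4 ≤ ∏ k, g k (α (e k)) := by
    intro α
    have hsub : Finset.range T ⊆ Finset.range L :=
      Finset.range_subset_range.2 ((Nat.lt_two_pow_self).le.trans hTL)
    have h1 : ∏ k, g k (α (e k)) = (∏ k ∈ Finset.range T, amplitudeFactor L α j k) ^ 4 := by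
      rw [← Fin.prod_univ_eq_prod_range, ← Finset.prod_pow]
      refine Finset.prod_congr rfl fun k _ => ?_
      simp only [g, e, amplitudeFactor, dif_pos (hlt k k.2)]
      split_ifs <;> rfl
    rw [h1, amplitude_eq_prod, ← Finset.prod_sdiff hsub, mul_pow]
    refine mul_le_of_le_one_left (Even.pow_nonneg (by decide) _) ?_
    rw [← Even.pow_abs (by decide)]
    refine pow_le_one₀ (abs_nonneg _) ?_
    rw [Finset.abs_prod]
    exact Finset.prod_le_one (fun _ _ => abs_nonneg _) fun k _ => abs_amplitudeFactor_le_one α j k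
  have hmp := measurePreserving_comp_injective e he
  have hG : Continuous fun y : Fin T → ℝ => ∏ k, g k (y k) :=
    continuous_finsetProd _ fun k _ => (hg k).comp (continuous_apply k)
  have hg1 : ∀ k t, |g k t| ≤ 1 := fun k t => by
    simp only [g]
    split_ifs
    · rw [abs_pow]; exact pow_le_one₀ (abs_nonneg _) (Real.abs_sin_le_one _)
    · rw [abs_pow]; exact pow_le_one₀ (abs_nonneg _) (Real.abs_cos_le_one _)
  have hgint : ∀ k, ∫ t, g k t ∂angleLaw = 3 / 8 := fun k => by
    simp only [g]
    split_ifs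
    · exact integral_sin_pow_four
    · exact integral_cos_pow_four
  calc ∫ α, amplitude L α j ^ 4 ∂anglesLaw (Fin (L - 1))
      ≤ ∫ α, ∏ k, g k (α (e k)) ∂anglesLaw (Fin (L - 1)) := by
        refine integral_mono ?_ ?_ hle
        · refine Integrable.of_bound (C := 1)
            ((differentiable_amplitude j).continuous.pow 4).aestronglyMeasurable
            (Filter.Eventually.of_forall fun α => ?_)
          rw [Real.norm_eq_abs, abs_pow]
          exact pow_le_one₀ (abs_nonneg _) (abs_amplitude_le_one α j)
        · refine Integrable.of_bound (C := 1) ?_ (Filter.Eventually.of_forall fun α => ?_)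
          · exact (hG.measurable.comp hmp.measurable).aestronglyMeasurable
          · rw [Real.norm_eq_abs, Finset.abs_prod]
            exact Finset.prod_le_one (fun _ _ => abs_nonneg _) fun k _ => hg1 k _
    _ = ∫ y, ∏ k, g k (y k) ∂anglesLaw (Fin T) := by
        rw [← hmp.map_eq, integral_map hmp.measurable.aemeasurable hG.aestronglyMeasurable]
    _ = (3 / 8) ^ T := by
        rw [anglesLaw, integral_fintype_prod_eq_prod]
        simp [hgint, div_pow]

end Amplitude

/-! ### The circuits on the blocks -/

section Rotation

variable {n : ℕ} {G : Matrix (Fin n) (Fin n) ℂ}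

/-- As `G² = 1`, the even terms of the exponential series are multiples of `1` and the odd ones
multiples of `G`, with the coefficients of cosine and sine. -/
theorem exp_mul_I_smul (hG : G * G = 1) (z : ℂ) :
    NormedSpace.exp ((z * Complex.I) • G) =
      Complex.cos z • (1 : Matrix (Fin n) (Fin n) ℂ) + (Complex.sin z * Complex.I) • G := by
  have hev : ∀ k, G ^ (2 * k) = 1 := fun k => by rw [pow_mul, sq, hG, one_pow]
  have h1 : HasSum (fun k : ℕ => ((Nat.factorial (2 * k) : ℂ)⁻¹) • ((z * Complex.I) • G) ^ (2 * k))
      (Complex.cos z • (1 : Matrix (Fin n) (Fin n) ℂ)) := by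
    have h := (Complex.hasSum_cos' z).smul_const (1 : Matrix (Fin n) (Fin n) ℂ)
    have e : (fun k : ℕ => ((Nat.factorial (2 * k) : ℂ)⁻¹) • ((z * Complex.I) • G) ^ (2 * k)) =
        fun k : ℕ => ((z * Complex.I) ^ (2 * k) / (Nat.factorial (2 * k) : ℂ)) •
          (1 : Matrix (Fin n) (Fin n) ℂ) := by
      funext k
      rw [smul_pow, hev, smul_smul, div_eq_inv_mul]
    rw [e]; exact h
  have h2 : HasSum (fun k : ℕ => ((Nat.factorial (2 * k + 1) : ℂ)⁻¹) •
      ((z * Complex.I) • G) ^ (2 * k + 1)) ((Complex.sin z * Complex.I) • G) := by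
    have h := ((Complex.hasSum_sin' z).mul_right Complex.I).smul_const G
    have e : (fun k : ℕ => ((Nat.factorial (2 * k + 1) : ℂ)⁻¹) •
        ((z * Complex.I) • G) ^ (2 * k + 1)) =
        fun k : ℕ => ((z * Complex.I) ^ (2 * k + 1) / (Nat.factorial (2 * k + 1) : ℂ) / Complex.I *
          Complex.I) • G := by
      funext k
      rw [smul_pow, pow_succ G, hev, one_mul, smul_smul, div_mul_cancel₀ _ Complex.I_ne_zero,
        div_eq_inv_mul]
    rw [e]; exact h
  rw [NormedSpace.exp_eq_tsum ℂ]
  exact (HasSum.even_add_odd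
    (f := fun k : ℕ => ((Nat.factorial k : ℂ)⁻¹) • ((z * Complex.I) • G) ^ k) h1 h2).tsum_eq

theorem exp_smul_of_mul_self_eq_one (hG : G * G = 1) (t : ℝ) :
    NormedSpace.exp ((-(Complex.I * (t : ℂ) / 2)) • G) =
      (Real.cos (t / 2) : ℂ) • (1 : Matrix (Fin n) (Fin n) ℂ) -
        ((Real.sin (t / 2) : ℂ) * Complex.I) • G := by
  have hw : -(Complex.I * (t : ℂ) / 2) = (-(t / 2)) * Complex.I := by ring
  rw [hw, exp_mul_I_smul hG, Complex.cos_neg, Complex.sin_neg, neg_mul, neg_smul, sub_eq_add_neg]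
  push_cast
  rfl

theorem exp_smul_mem_unitaryGroup (hG : G * G = 1) (hH : G.IsHermitian) (t : ℝ) :
    NormedSpace.exp ((-(Complex.I * (t : ℂ) / 2)) • G) ∈ Matrix.unitaryGroup (Fin n) ℂ := by
  rw [exp_smul_of_mul_self_eq_one hG, Matrix.mem_unitaryGroup_iff', Matrix.star_eq_conjTranspose]
  have hcs : (Real.cos (t / 2) : ℂ) * Real.cos (t / 2) + Real.sin (t / 2) * Real.sin (t / 2) = 1 := by
    have := Real.cos_sq_add_sin_sq (t / 2)
    rw [← Complex.ofReal_mul, ← Complex.ofReal_mul, ← Complex.ofReal_add, ← sq, ← sq, this,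
      Complex.ofReal_one]
  simp only [Matrix.conjTranspose_sub, Matrix.conjTranspose_smul, hH.eq, Matrix.conjTranspose_one,
    star_mul', RCLike.star_def, Complex.conj_ofReal, Complex.conj_I, sub_mul, mul_sub,
    Matrix.smul_mul, Matrix.mul_smul, Matrix.one_mul, Matrix.mul_one, hG, smul_smul]
  have hI : (Real.sin (t / 2) : ℂ) * Complex.I * (Real.sin (t / 2) * -Complex.I) =
      Real.sin (t / 2) * Real.sin (t / 2) := by
    linear_combination (-(Real.sin (t / 2) : ℂ) * Real.sin (t / 2)) * Complex.I_sq
  rw [hI]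
  calc _ = ((Real.cos (t / 2) : ℂ) * Real.cos (t / 2) + Real.sin (t / 2) * Real.sin (t / 2)) •
        (1 : Matrix (Fin n) (Fin n) ℂ) := by module
    _ = 1 := by rw [hcs, one_smul]

end Rotation

/-- With the other factors frozen, an ordered product sees one factor through two-sided
multiplication only. This isolates a single gate of the circuit. -/
theorem exists_list_prod_update {R : Type*} [Monoid R] :
    ∀ {n : ℕ} (X : Fin n → R) (l : Fin n), ∃ A B : R, ∀ Y : R,
      (List.ofFn (Function.update X l Y)).prod = A * Y * B
  | 0, _, l => l.elim0
  | n + 1, X, l => by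
    refine Fin.cases ?_ (fun l => ?_) l
    · refine ⟨1, (List.ofFn fun k : Fin n => X k.succ).prod, fun Y => ?_⟩
      simp [List.ofFn_succ]
    · obtain ⟨A, B, h⟩ := exists_list_prod_update (fun k : Fin n => X k.succ) l
      refine ⟨X 0 * A, B, fun Y => ?_⟩
      rw [List.ofFn_succ, List.prod_cons, Function.update_of_ne (Fin.succ_ne_zero l).symm, mul_assoc,
        mul_assoc, ← mul_assoc A, ← h]
      congr 3
      funext k
      by_cases hk : k = l
      · subst hk; simp
      · rw [Function.update_of_ne hk, Function.update_of_ne (by simpa using hk)]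

theorem differentiable_list_prod {E : Type*} [NormedAddCommGroup E] [NormedSpace ℝ E] {m : ℕ} :
    ∀ {n : ℕ} (F : Fin n → E → Matrix (Fin m) (Fin m) ℂ),
      (∀ k a b, Differentiable ℝ fun x => F k x a b) →
      ∀ a b, Differentiable ℝ fun x => (List.ofFn fun k => F k x).prod a b
  | 0, F, _, a, b => by simp
  | n + 1, F, hF, a, b => by
    simp only [List.ofFn_succ, List.prod_cons, Matrix.mul_apply]
    have := differentiable_list_prod (fun k : Fin n => F k.succ) fun k => hF k.succ
    exact Differentiable.fun_sum fun c _ => (hF 0 a c).mul (this c b)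

namespace Network

variable {N : ℕ} {H : Finset (Fin (N / 2 + 1))} (A : Network N H)

theorem circuit_mem_unitaryGroup (μ : H) (θ : Fin (A.gates μ) → ℝ) :
    A.circuit μ θ ∈ Matrix.unitaryGroup (Fin (blockDim N μ)) ℂ := by
  refine mul_mem (A.fixed μ 0).2 (list_prod_mem fun X hX => ?_)
  obtain ⟨l, rfl⟩ := List.mem_ofFn.1 hX
  exact mul_mem (exp_smul_mem_unitaryGroup (A.gen_sq μ l) (A.gen_hermitian μ l) _)
    (A.fixed μ l.succ).2

theorem differentiable_circuit (μ : H) (a b : Fin (blockDim N μ)) :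
    Differentiable ℝ fun θ : Fin (A.gates μ) → ℝ => A.circuit μ θ a b := by
  have h := differentiable_list_prod (fun (l : Fin (A.gates μ)) (θ : Fin (A.gates μ) → ℝ) =>
    NormedSpace.exp ((-(Complex.I * (θ l : ℂ) / 2)) • A.gen μ l) *
      (A.fixed μ l.succ : Matrix (Fin (blockDim N μ)) (Fin (blockDim N μ)) ℂ))
        (fun l c d => by
          simp only [exp_smul_of_mul_self_eq_one (A.gen_sq μ l), Matrix.mul_apply,
            Matrix.sub_apply, Matrix.smul_apply]
          fun_prop)
  simp only [circuit]
  rw [show (fun θ : Fin (A.gates μ) → ℝ => ((A.fixed μ 0 :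
      Matrix (Fin (blockDim N μ)) (Fin (blockDim N μ)) ℂ) * _ : Matrix _ _ ℂ) a b) = fun θ => ∑ c,
        (A.fixed μ 0 : Matrix (Fin (blockDim N μ)) (Fin (blockDim N μ)) ℂ) a c * _ from
    funext fun θ => Matrix.mul_apply]
  exact Differentiable.fun_sum fun c _ => (h c b).const_mul _

theorem exists_circuit_update (μ : H) (θ : Fin (A.gates μ) → ℝ) (l : Fin (A.gates μ)) :
    ∃ X Y : Matrix (Fin (blockDim N μ)) (Fin (blockDim N μ)) ℂ, ∀ t : ℝ,
      A.circuit μ (Function.update θ l t) =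
        (Real.cos (t / 2) : ℂ) • X + (Real.sin (t / 2) : ℂ) • Y := by
  let R : Fin (A.gates μ) → ℝ → Matrix (Fin (blockDim N μ)) (Fin (blockDim N μ)) ℂ := fun k t =>
    NormedSpace.exp ((-(Complex.I * (t : ℂ) / 2)) • A.gen μ k) *
        (A.fixed μ k.succ : Matrix (Fin (blockDim N μ)) (Fin (blockDim N μ)) ℂ)
  obtain ⟨B, C, h⟩ := exists_list_prod_update (fun k => R k (θ k)) l
  refine ⟨A.fixed μ 0 * (B * A.fixed μ l.succ * C),
    A.fixed μ 0 * (B * ((-Complex.I) • (A.gen μ l * A.fixed μ l.succ)) * C), fun t => ?_⟩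
  have hu : (fun k => R k (Function.update θ l t k)) =
      Function.update (fun k => R k (θ k)) l (R l t) := by
    funext k
    by_cases hk : k = l
    · subst hk; simp
    · simp [Function.update_of_ne hk]
  have hc : A.circuit μ (Function.update θ l t) =
      A.fixed μ 0 * (List.ofFn fun k => R k (Function.update θ l t k)).prod := rfl
  rw [hc, hu, h]
  simp only [R, exp_smul_of_mul_self_eq_one (A.gen_sq μ l)]
  simp only [sub_mul, mul_sub, Matrix.smul_mul, Matrix.mul_smul, Matrix.one_mul, smul_smul]
  module

theorem init_normSq (μ : H) : ∑ a, Complex.normSq (A.init μ a) = 1 := by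
  simpa [Complex.sq_norm] using A.init_norm μ

theorem norm_blockState (μ : H) (θ : Fin (A.gates μ) → ℝ) : ‖A.blockState μ θ‖ = 1 := by
  have hb : A.blockState μ θ = ((∑ a, (A.circuit μ θ *ᵥ A.init μ) a • A.basis μ a :
      block N μ) : Qubits N) := by
    simp [blockState]
  have h := (A.basis μ).sum_sq_norm_inner_right
    (∑ a, (A.circuit μ θ *ᵥ A.init μ) a • A.basis μ a)
  simp only [(A.basis μ).orthonormal.inner_right_fintype, Complex.sq_norm,
    sum_normSq_mulVec_of_mem_unitaryGroup (A.circuit_mem_unitaryGroup μ θ), A.init_normSq] at h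
  rw [hb, Submodule.norm_coe]
  nlinarith [norm_nonneg (∑ a, (A.circuit μ θ *ᵥ A.init μ) a • A.basis μ a)]

theorem blockState_mem (μ : H) (θ : Fin (A.gates μ) → ℝ) : A.blockState μ θ ∈ block N μ :=
  Submodule.sum_mem _ fun a _ => Submodule.smul_mem _ _ (A.basis μ a).2

theorem differentiable_blockState (μ : H) : Differentiable ℝ (A.blockState μ) := by
  unfold blockState
  refine Differentiable.fun_sum fun a _ => Differentiable.smul_const ?_ _
  simp only [Matrix.mulVec, dotProduct]
  exact Differentiable.fun_sum fun b _ => (A.differentiable_circuit μ a b).mul_const _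

/-- The contribution `⟨ψ_μ|O|ψ_μ⟩` of the block `μ` to the cost. -/
noncomputable def blockCost (O : Qubits N →L[ℂ] Qubits N) (μ : H) (θ : Fin (A.gates μ) → ℝ) : ℝ :=
  (inner ℂ (A.blockState μ θ) (O (A.blockState μ θ))).re

variable (O : Qubits N →L[ℂ] Qubits N)

theorem differentiable_blockCost (μ : H) : Differentiable ℝ (A.blockCost O μ) := by
  have h := A.differentiable_blockState μ
  have h2 : Differentiable ℝ fun θ => O (A.blockState μ θ) :=
    (O.restrictScalars ℝ).differentiable.comp h
  exact Complex.reCLM.differentiable.comp (h.inner ℂ h2)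

theorem abs_blockCost_le (μ : H) (θ : Fin (A.gates μ) → ℝ) : |A.blockCost O μ θ| ≤ ‖O‖ := by
  refine (Complex.abs_re_le_norm _).trans ((norm_inner_le_norm _ _).trans ?_)
  have := O.le_opNorm (A.blockState μ θ)
  rw [A.norm_blockState] at this ⊢
  linarith

/-- The state is linear in `(cos (t/2), sin (t/2))` and the cost is quadratic in the state, so the
half angles combine to frequency one. -/
theorem isSinusoid_blockCost (μ : H) (θ : Fin (A.gates μ) → ℝ) (l : Fin (A.gates μ)) :
    IsSinusoid (1 : ℕ) fun t => A.blockCost O μ (Function.update θ l t) := by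
  obtain ⟨X, Y, h⟩ := A.exists_circuit_update μ θ l
  set p : Qubits N := ∑ a, (X *ᵥ A.init μ) a • (A.basis μ a : Qubits N)
  set q : Qubits N := ∑ a, (Y *ᵥ A.init μ) a • (A.basis μ a : Qubits N)
  have hs : ∀ t, A.blockState μ (Function.update θ l t) =
      (Real.cos (t / 2) : ℂ) • p + (Real.sin (t / 2) : ℂ) • q := by
    intro t
    simp only [blockState, h, p, q, Finset.smul_sum, ← Finset.sum_add_distrib, smul_smul,
      ← add_smul]
    simp [Matrix.add_mulVec, Matrix.smul_mulVec]
  refine ⟨((inner ℂ p (O p)).re + (inner ℂ q (O q)).re) / 2,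
    ((inner ℂ p (O p)).re - (inner ℂ q (O q)).re) / 2,
    ((inner ℂ p (O q)).re + (inner ℂ q (O p)).re) / 2, fun t => ?_⟩
  have h1 : ((1 : ℕ) : ℝ) * t = 2 * (t / 2) := by push_cast; ring
  simp only [blockCost, hs, map_add, map_smul, inner_add_left, inner_add_right, inner_smul_left,
    inner_smul_right, Complex.add_re, Complex.conj_ofReal, Complex.re_ofReal_mul]
  rw [h1, Real.cos_two_mul, Real.sin_two_mul]
  have := Real.sin_sq (t / 2)
  linear_combination (inner ℂ q (O q)).re * this

theorem continuous_blockCost (μ : H) : Continuous (A.blockCost O μ) :=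
  (A.differentiable_blockCost O μ).continuous

end Network

/-! ### Orthogonality of the blocks -/

section Orthogonality

variable {N : ℕ}

/-- For `g ∈ SU(2)` the adjoint of `g^{⊗ N}` belongs to the action again. Orthogonal complements of
invariant subspaces are therefore invariant, and orthogonal projections onto them equivariant. -/
theorem inner_tensorPower_left (g : Matrix (Fin 2) (Fin 2) ℂ) (v w : Qubits N) :
    inner ℂ (tensorPower N g v) w = inner ℂ v (tensorPower N (star g) w) := by
  have h : tensorPower N (star g) = LinearMap.adjoint (tensorPower N g) := by
    rw [tensorPower, tensorPower, ← Matrix.toEuclideanLin_conjTranspose_eq_adjoint]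
    congr 1
    ext x y
    simp [Matrix.conjTranspose_apply]
  rw [h, LinearMap.adjoint_inner_right]

theorem star_mem_specialUnitaryGroup {g : Matrix (Fin 2) (Fin 2) ℂ}
    (hg : g ∈ Matrix.specialUnitaryGroup (Fin 2) ℂ) :
    star g ∈ Matrix.specialUnitaryGroup (Fin 2) ℂ :=
  (star (⟨g, hg⟩ : Matrix.specialUnitaryGroup (Fin 2) ℂ)).2

theorem IsInvariant.orthogonal {T : Submodule ℂ (Qubits N)} (hT : IsInvariant T) :
    IsInvariant Tᗮ := by
  intro g hg v hv t ht
  rw [← star_star g, ← inner_tensorPower_left]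
  exact hv _ (hT _ (star_mem_specialUnitaryGroup hg) t ht)

theorem IsInvariant.inf {S T : Submodule ℂ (Qubits N)} (hS : IsInvariant S) (hT : IsInvariant T) :
    IsInvariant (S ⊓ T) :=
  fun g hg v hv => ⟨hS g hg v hv.1, hT g hg v hv.2⟩

theorem starProjection_tensorPower {T : Submodule ℂ (Qubits N)} (hT : IsInvariant T)
    {g : Matrix (Fin 2) (Fin 2) ℂ} (hg : g ∈ Matrix.specialUnitaryGroup (Fin 2) ℂ) (v : Qubits N) :
    T.starProjection (tensorPower N g v) = tensorPower N g (T.starProjection v) := by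
  refine Submodule.eq_starProjection_of_mem_of_inner_eq_zero
    (hT g hg _ (Submodule.starProjection_apply_mem T v)) fun w hw => ?_
  rw [← map_sub]
  have := hT.orthogonal g hg _ (Submodule.sub_starProjection_mem_orthogonal (K := T) v)
  exact (Submodule.mem_orthogonal' _ _).1 this w hw

theorem IsInvariant.map_starProjection {S T : Submodule ℂ (Qubits N)} (hS : IsInvariant S)
    (hT : IsInvariant T) :
    IsInvariant (S.map (T.starProjection : Qubits N →ₗ[ℂ] Qubits N)) := by
  rintro g hg _ ⟨v, hv, rfl⟩
  exact ⟨tensorPower N g v, hS g hg v hv, starProjection_tensorPower hT hg v⟩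

/-- Irreducible subrepresentations of different dimensions are orthogonal. -/
theorem IsIrreducible.isOrtho {S T : Submodule ℂ (Qubits N)} (hS : IsIrreducible S)
    (hT : IsIrreducible T) (h : Module.finrank ℂ S ≠ Module.finrank ℂ T) : S ⟂ T := by
  -- Schur's lemma: if `S ⊓ Tᗮ = ⊥`, the projection onto `T` embeds `S` equivariantly with image `⊥`
  -- or `T`; the first contradicts `S ≠ ⊥`, the second the dimensions.
  rcases hS.2.2 (S ⊓ Tᗮ) inf_le_left (hS.1.inf hT.1.orthogonal) with h0 | h0
  · exfalso
    have hinj : ∀ v ∈ S, T.starProjection v = 0 → v = 0 := fun v hv h1 => by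
      have : v ∈ S ⊓ Tᗮ := ⟨hv, (Submodule.starProjection_apply_eq_zero_iff T).1 h1⟩
      rw [h0] at this
      exact this
    have hfr : Module.finrank ℂ (S.map (T.starProjection : Qubits N →ₗ[ℂ] Qubits N)) =
        Module.finrank ℂ S := by
      rw [← LinearMap.range_domRestrict]
      refine LinearMap.finrank_range_of_inj
        ((injective_iff_map_eq_zero _).2 fun v hv => Subtype.ext (hinj v v.2 hv))
    rcases hT.2.2 (S.map (T.starProjection : Qubits N →ₗ[ℂ] Qubits N))
      (by rintro _ ⟨v, _, rfl⟩; exact Submodule.starProjection_apply_mem T v)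
      (hS.1.map_starProjection hT.1) with h1 | h1
    · rw [h1, finrank_bot] at hfr
      exact hS.2.1 (Submodule.finrank_eq_zero.1 hfr.symm)
    · rw [h1] at hfr
      exact h hfr.symm
  · exact inf_eq_left.1 h0

theorem block_isOrtho {j k : Fin (N / 2 + 1)} (h : j ≠ k) : block N j ⟂ block N k := by
  refine Submodule.isOrtho_sSup_left.2 fun S hS => Submodule.isOrtho_sSup_right.2 fun T hT => ?_
  refine hS.1.isOrtho hT.1 ?_
  rw [hS.2, hT.2]
  have := j.2
  have := k.2
  have : (j : ℕ) ≠ k := fun h' => h (Fin.ext h')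
  omega

end Orthogonality

/-! ### The cost as a sum over the blocks. -/

namespace Network

variable {N : ℕ} {H : Finset (Fin (N / 2 + 1))} (A : Network N H)

/-- The contribution `c_μ(α)² ⟨ψ_μ|O|ψ_μ⟩` of the block `μ` to the cost. -/
noncomputable def costTerm (O : Qubits N →L[ℂ] Qubits N) (μ : H) (x : A.Param → ℝ) : ℝ :=
  amplitude H.card (fun i => x (Sum.inl i)) (A.label.symm μ) ^ 2 *
    A.blockCost O μ fun l => x (Sum.inr ⟨μ, l⟩)

variable {O : Qubits N →L[ℂ] Qubits N}

theorem cost_eq_sum (hO : IsBlockObservable H O) (x : A.Param → ℝ) :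
    A.cost O x = ∑ μ : H, A.costTerm O μ x := by
  simp only [cost, state, map_sum, map_smul, sum_inner, inner_sum, Complex.re_sum, inner_smul_left,
    inner_smul_right, Complex.conj_ofReal, Complex.re_ofReal_mul]
  refine Finset.sum_congr rfl fun μ _ => ?_
  rw [Finset.sum_eq_single μ]
  · rw [costTerm, blockCost]; ring
  · intro ν _ hν
    have : inner ℂ (A.blockState ν fun l => x (Sum.inr ⟨ν, l⟩))
        (O (A.blockState μ fun l => x (Sum.inr ⟨μ, l⟩))) = 0 :=
      Submodule.isOrtho_iff_inner_eq.1 (block_isOrtho fun h => hν (Subtype.ext h)) _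
        (A.blockState_mem ν _) _ (hO.mapsTo μ μ.2 _ (A.blockState_mem μ _))
    simp [this]
  · simp

theorem differentiable_costTerm (O : Qubits N →L[ℂ] Qubits N) (μ : H) :
    Differentiable ℝ (A.costTerm O μ) := by
  have h1 := (differentiable_amplitude (A.label.symm μ)).comp
    (f := fun (x : A.Param → ℝ) i => x (Sum.inl i)) (by fun_prop)
  have h2 := (A.differentiable_blockCost O μ).comp
    (f := fun (x : A.Param → ℝ) l => x (Sum.inr ⟨μ, l⟩)) (by fun_prop)
  exact (h1.pow 2).mul h2

theorem abs_costTerm_le (O : Qubits N →L[ℂ] Qubits N) (μ : H) (x : A.Param → ℝ) :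
    |A.costTerm O μ x| ≤ ‖O‖ := by
  rw [costTerm, abs_mul, abs_pow]
  exact (mul_le_of_le_one_left (abs_nonneg _) (pow_le_one₀ (abs_nonneg _)
    (abs_amplitude_le_one _ _))).trans (A.abs_blockCost_le O μ _)

theorem isSinusoid_costTerm_inl (O : Qubits N →L[ℂ] Qubits N) (μ : H) (i : Fin (H.card - 1))
    (x : A.Param → ℝ) :
    IsSinusoid (2 : ℕ) fun t => A.costTerm O μ (Function.update x (Sum.inl i) t) := by
  have h : ∀ t, (fun k => Function.update x (Sum.inl i : A.Param) t (Sum.inl k)) =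
      Function.update (fun k => x (Sum.inl k)) i t := fun t => by
    funext k
    by_cases hk : k = i
    · subst hk; simp
    · simp [Function.update_of_ne, hk]
  simp only [costTerm, h, mul_comm (amplitude _ _ _ ^ 2)]
  simpa using (isSinusoid_amplitude_sq (fun k => x (Sum.inl k)) (A.label.symm μ) i).const_mul _

theorem isSinusoid_costTerm_inr (O : Qubits N →L[ℂ] Qubits N) (μ : H) (l : Fin (A.gates μ))
    (x : A.Param → ℝ) :
    IsSinusoid (1 : ℕ) fun t => A.costTerm O μ (Function.update x (Sum.inr ⟨μ, l⟩) t) := by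
  have h : ∀ t, (fun k => Function.update x (Sum.inr ⟨μ, l⟩ : A.Param) t (Sum.inr ⟨μ, k⟩)) =
      Function.update (fun k => x (Sum.inr ⟨μ, k⟩)) l t := fun t => by
    funext k
    by_cases hk : k = l
    · subst hk; simp
    · simp [Function.update_of_ne, hk]
  simp only [costTerm, h]
  simpa using (A.isSinusoid_blockCost O μ (fun k => x (Sum.inr ⟨μ, k⟩)) l).const_mul _

theorem costTerm_update_inr_of_ne (O : Qubits N →L[ℂ] Qubits N) {μ ν : H} (h : ν ≠ μ)
    (l : Fin (A.gates μ)) (x : A.Param → ℝ) (t : ℝ) :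
    A.costTerm O ν (Function.update x (Sum.inr ⟨μ, l⟩) t) = A.costTerm O ν x := by
  simp [costTerm, Function.update_of_ne, h]

/-! ### The second moment of the cost -/

theorem blockDim_pos {N : ℕ} {H : Finset (Fin (N / 2 + 1))} (A : Network N H) (μ : H) :
    0 < blockDim N μ := by
  by_contra h
  have : IsEmpty (Fin (blockDim N μ)) := by
    rw [Nat.eq_zero_of_not_pos h]; infer_instance
  simpa using A.init_norm μ

theorem integral_blockCost_sq_le (hA : A.BlocksAreTwoDesigns) (hO : IsBlockObservable H O)
    (μ : H) :
    ∫ θ, A.blockCost O μ θ ^ 2 ∂anglesLaw (Fin (A.gates μ)) ≤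
      ‖O‖ ^ 2 / (blockDim N μ + 1) := by
  have hsymm : (O : Qubits N →ₗ[ℂ] Qubits N).IsSymmetric :=
    ContinuousLinearMap.isSelfAdjoint_iff_isSymmetric.1 hO.selfAdjoint
  let M : Matrix (Fin (blockDim N μ)) (Fin (blockDim N μ)) ℂ := Matrix.of fun a b =>
    inner ℂ (A.basis μ a : Qubits N) (O (A.basis μ b))
  have hM : M.IsHermitian := by
    ext a b
    simp only [M, Matrix.conjTranspose_apply, Matrix.of_apply, RCLike.star_def, inner_conj_symm]
    exact hsymm _ _
  have hM0 : M.trace = 0 := by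
    rw [← hO.traceless μ μ.2, LinearMap.trace_eq_sum_inner _ (A.basis μ)]
    rfl
  have hquad : ∀ θ, A.blockCost O μ θ = (star (A.circuit μ θ *ᵥ A.init μ) ⬝ᵥ
      (M *ᵥ (A.circuit μ θ *ᵥ A.init μ))).re := by
    intro θ
    simp only [blockCost, blockState]
    generalize A.circuit μ θ *ᵥ A.init μ = u
    congr 1
    simp only [map_sum, map_smul, sum_inner, inner_sum, inner_smul_left, inner_smul_right,
      dotProduct, Matrix.mulVec, Finset.mul_sum]
    rw [Finset.sum_comm]
    refine Finset.sum_congr rfl fun a _ => Finset.sum_congr rfl fun b _ => ?_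
    simp only [M, Matrix.of_apply, Pi.star_apply, RCLike.star_def]
    ring
  -- Bessel's inequality bounds the squared norm of each column of `M` by `‖O‖²`.
  have hsum : ∑ a, ∑ b, Complex.normSq (M a b) ≤ blockDim N μ * ‖O‖ ^ 2 := by
    rw [Finset.sum_comm]
    have : ∀ b, ∑ a, Complex.normSq (M a b) ≤ ‖O‖ ^ 2 := fun b => by
      have hon : Orthonormal ℂ fun a => (A.basis μ a : Qubits N) :=
        (A.basis μ).orthonormal.comp_linearIsometry (block N μ).subtypeₗᵢ
      have h1 := hon.sum_inner_products_le (s := Finset.univ) (O (A.basis μ b))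
      have h2 := O.le_opNorm (A.basis μ b)
      have h3 : ‖(A.basis μ b : Qubits N)‖ = 1 := hon.1 b
      rw [h3, mul_one] at h2
      simp only [Complex.sq_norm] at h1
      exact h1.trans (pow_le_pow_left₀ (norm_nonneg _) h2 2)
    refine (Finset.sum_le_sum fun b _ => this b).trans ?_
    simp
  simp_rw [hquad]
  rw [integral_twoDesign_quadratic_sq _ (hA μ)
    (fun a b => (A.differentiable_circuit μ a b).continuous.measurable)
    (A.circuit_mem_unitaryGroup μ) (A.init_normSq μ) hM hM0]
  have hpos : (0 : ℝ) < blockDim N μ := by exact_mod_cast A.blockDim_pos μ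
  rw [div_le_div_iff₀ (by positivity) (by positivity)]
  nlinarith

theorem integral_costTerm_sq_le (hA : A.BlocksAreTwoDesigns) (hO : IsBlockObservable H O)
    (μ : H) :
    ∫ x, A.costTerm O μ x ^ 2 ∂A.law ≤
      (3 / 8) ^ Nat.log 2 H.card * (‖O‖ ^ 2 / (blockDim N μ + 1)) := by
  let e : Fin (H.card - 1) ⊕ Fin (A.gates μ) → A.Param := Sum.map id fun l => ⟨μ, l⟩
  have he : Function.Injective e :=
    Sum.map_injective.2 ⟨Function.injective_id, fun l l' h => by simpa using h⟩
  have h := integral_mul_of_disjoint_coordinates e he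
    (fun α => amplitude H.card α (A.label.symm μ) ^ 4) (fun θ => A.blockCost O μ θ ^ 2)
    ((differentiable_amplitude _).continuous.pow 4).measurable
    ((A.continuous_blockCost O μ).pow 2).measurable
  have h2 : ∀ x, A.costTerm O μ x ^ 2 =
      amplitude H.card (fun k => x (e (Sum.inl k))) (A.label.symm μ) ^ 4 *
        A.blockCost O μ (fun k => x (e (Sum.inr k))) ^ 2 := fun x => by
    simp only [costTerm, e, Sum.map_inl, Sum.map_inr, id]
    ring
  simp_rw [h2]
  rw [law, h]
  exact mul_le_mul (integral_amplitude_pow_four_le _) (A.integral_blockCost_sq_le hA hO μ)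
    (integral_nonneg fun _ => sq_nonneg _) (by positivity)

end Network

/-! ### Highest weight vectors -/

section HighestWeight

variable {V : Type*} [AddCommGroup V] [Module ℂ V] {e f h : Module.End ℂ V} {v : V} {n : ℕ}

theorem lie_h_pow_f (hf : h * f - f * h = (-2 : ℂ) • f) (hv : h v = (n : ℂ) • v) (k : ℕ) :
    h ((f ^ k) v) = ((n : ℂ) - 2 * k) • (f ^ k) v := by
  induction k with
  | zero => simpa using hv
  | succ k ih =>
    have h1 : h (f ((f ^ k) v)) = f (h ((f ^ k) v)) + (-2 : ℂ) • f ((f ^ k) v) := by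
      have := LinearMap.congr_fun hf ((f ^ k) v)
      simp only [LinearMap.sub_apply, Module.End.mul_apply, LinearMap.smul_apply] at this
      rw [← this]; abel
    rw [pow_succ', Module.End.mul_apply, h1, ih, map_smul, ← add_smul]
    congr 1
    push_cast; ring

/-- Moving `e` past each `f` in turn adds the weights `n, n - 2, …, n - 2 k`, whose sum is the
coefficient. For natural `k` it vanishes at `k = n` only. -/
theorem lie_e_pow_succ_f (hf : h * f - f * h = (-2 : ℂ) • f) (hef : e * f - f * e = h)
    (hv : h v = (n : ℂ) • v) (he : e v = 0) (k : ℕ) :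
    e ((f ^ (k + 1)) v) = (((k : ℂ) + 1) * (n - k)) • (f ^ k) v := by
  have h1 : ∀ w, e (f w) = f (e w) + h w := fun w => by
    rw [← hef]; simp
  induction k with
  | zero => simp [h1, he, hv]
  | succ k ih =>
    rw [pow_succ' f (k + 1), Module.End.mul_apply, h1, ih, lie_h_pow_f hf hv, map_smul,
      ← Module.End.mul_apply f, ← pow_succ', ← add_smul]
    congr 1
    push_cast; ring

theorem pow_f_ne_zero (hf : h * f - f * h = (-2 : ℂ) • f) (hef : e * f - f * e = h)
    (hv : h v = (n : ℂ) • v) (he : e v = 0) (hv0 : v ≠ 0) {k : ℕ} (hk : k ≤ n) :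
    (f ^ k) v ≠ 0 := by
  induction k with
  | zero => simpa using hv0
  | succ k ih =>
    intro h0
    have := lie_e_pow_succ_f hf hef hv he k
    rw [h0, map_zero, eq_comm, smul_eq_zero] at this
    refine this.elim (fun h1 => ?_) (ih (by omega))
    refine (mul_ne_zero (by exact_mod_cast k.succ_ne_zero) (sub_ne_zero.2 ?_)) h1
    exact_mod_cast (by omega : n ≠ k)

/-- Were this power nonzero, all later ones would be too, since the coefficients of `e` do not
vanish beyond `k = n`. They would be eigenvectors of `h` for infinitely many eigenvalues. -/
theorem pow_f_eq_zero [FiniteDimensional ℂ V] (hf : h * f - f * h = (-2 : ℂ) • f)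
    (hef : e * f - f * e = h) (hv : h v = (n : ℂ) • v) (he : e v = 0) :
    (f ^ (n + 1)) v = 0 := by
  by_contra h0
  have hne : ∀ m, (f ^ (n + 1 + m)) v ≠ 0 := by
    intro m
    induction m with
    | zero => exact h0
    | succ m ih =>
      intro h1
      have := lie_e_pow_succ_f hf hef hv he (n + 1 + m)
      rw [← add_assoc] at h1
      rw [h1, map_zero, eq_comm, smul_eq_zero] at this
      refine this.elim (fun h2 => ?_) ih
      refine (mul_ne_zero (by exact_mod_cast (n + 1 + m).succ_ne_zero) (sub_ne_zero.2 ?_)) h2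
      exact_mod_cast (by omega : n ≠ n + 1 + m)
  have hli := Module.End.eigenvectors_linearIndependent' h
    (fun m : ℕ => (n : ℂ) - 2 * ((n + 1 + m : ℕ) : ℂ)) (fun a b hab => by
      have : (a : ℂ) = b := by
        simp only at hab
        push_cast at hab
        linear_combination (-1 / 2 : ℂ) * hab
      exact_mod_cast this) (fun m => (f ^ (n + 1 + m)) v) fun m =>
        ⟨Module.End.mem_eigenspace_iff.2 (lie_h_pow_f hf hv _), hne m⟩
  have := hli.finite
  exact not_finite ℕ

theorem finrank_span_pow_f (hf : h * f - f * h = (-2 : ℂ) • f) (hef : e * f - f * e = h)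
    (hv : h v = (n : ℂ) • v) (he : e v = 0) (hv0 : v ≠ 0) :
    Module.finrank ℂ (Submodule.span ℂ ((fun k => (f ^ k) v) '' Set.Iio (n + 1))) = n + 1 := by
  have hli : LinearIndependent ℂ fun k : Fin (n + 1) => (f ^ (k : ℕ)) v :=
    Module.End.eigenvectors_linearIndependent' h
      (fun k : Fin (n + 1) => (n : ℂ) - 2 * ((k : ℕ) : ℂ)) (fun a b hab => by
        have : ((a : ℕ) : ℂ) = (b : ℕ) := by
          simp only at hab
          linear_combination (-1 / 2 : ℂ) * hab
        exact Fin.ext (by exact_mod_cast this)) _ fun k =>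
          ⟨Module.End.mem_eigenspace_iff.2 (lie_h_pow_f hf hv _),
            pow_f_ne_zero hf hef hv he hv0 (by omega)⟩
  have hr : (fun k => (f ^ k) v) '' Set.Iio (n + 1) =
      Set.range fun k : Fin (n + 1) => (f ^ (k : ℕ)) v := by
    ext w
    simp only [Set.mem_image, Set.mem_Iio, Set.mem_range]
    exact ⟨fun ⟨k, hk, h⟩ => ⟨⟨k, hk⟩, h⟩, fun ⟨k, h⟩ => ⟨k, k.2, h⟩⟩
  rw [hr, finrank_span_eq_card hli, Fintype.card_fin]

theorem span_pow_f_stable [FiniteDimensional ℂ V] (hf : h * f - f * h = (-2 : ℂ) • f)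
    (hef : e * f - f * e = h) (hv : h v = (n : ℂ) • v) (he : e v = 0) {w : V}
    (hw : w ∈ Submodule.span ℂ ((fun k => (f ^ k) v) '' Set.Iio (n + 1))) :
    e w ∈ Submodule.span ℂ ((fun k => (f ^ k) v) '' Set.Iio (n + 1)) ∧
    f w ∈ Submodule.span ℂ ((fun k => (f ^ k) v) '' Set.Iio (n + 1)) ∧
    h w ∈ Submodule.span ℂ ((fun k => (f ^ k) v) '' Set.Iio (n + 1)) := by
  set S := Submodule.span ℂ ((fun k => (f ^ k) v) '' Set.Iio (n + 1))
  have hmem : ∀ k, (f ^ k) v ∈ S := by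
    intro k
    by_cases hk : k < n + 1
    · exact Submodule.subset_span ⟨k, hk, rfl⟩
    · obtain ⟨m, rfl⟩ := Nat.exists_eq_add_of_le (not_lt.1 hk)
      rw [add_comm, pow_add, Module.End.mul_apply, pow_f_eq_zero hf hef hv he, map_zero]
      exact S.zero_mem
  have key : ∀ g : Module.End ℂ V, (∀ k, g ((f ^ k) v) ∈ S) → g w ∈ S := by
    intro g hg
    have : S ≤ S.comap g := Submodule.span_le.2 (by rintro _ ⟨k, _, rfl⟩; exact hg k)
    exact this hw
  refine ⟨key e fun k => ?_, key f fun k => ?_, key h fun k => ?_⟩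
  · cases k with
    | zero => simp [he]
    | succ k => rw [lie_e_pow_succ_f hf hef hv he]; exact S.smul_mem _ (hmem k)
  · rw [← Module.End.mul_apply, ← pow_succ']; exact hmem _
  · rw [lie_h_pow_f hf hv]; exact S.smul_mem _ (hmem k)

/-- `e ^ m` reads off a leading coefficient along the chain `f ^ k v`, which is how `v` is recovered
from an arbitrary vector of the span. -/
theorem exists_pow_e_pow_f (hf : h * f - f * h = (-2 : ℂ) • f) (hef : e * f - f * e = h)
    (hv : h v = (n : ℂ) • v) (he : e v = 0) {m : ℕ} (hm : m ≤ n) :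
    (∃ c : ℂ, c ≠ 0 ∧ (e ^ m) ((f ^ m) v) = c • v) ∧ ∀ k < m, (e ^ m) ((f ^ k) v) = 0 := by
  induction m with
  | zero => exact ⟨⟨1, one_ne_zero, by simp⟩, by simp⟩
  | succ m ih =>
    obtain ⟨⟨c, hc, h1⟩, h2⟩ := ih (by omega)
    refine ⟨⟨((m : ℂ) + 1) * (n - m) * c, ?_, ?_⟩, fun k hk => ?_⟩
    · refine mul_ne_zero (mul_ne_zero (by exact_mod_cast m.succ_ne_zero) (sub_ne_zero.2 ?_)) hc
      exact_mod_cast (by omega : n ≠ m)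
    · rw [pow_succ e, Module.End.mul_apply, lie_e_pow_succ_f hf hef hv he, map_smul, h1, smul_smul]
    · rw [pow_succ e, Module.End.mul_apply]
      cases k with
      | zero => simp [he]
      | succ k => rw [lie_e_pow_succ_f hf hef hv he, map_smul, h2 k (by omega), smul_zero]

/-- If `f ^ m v` is the top term of a nonzero `u ∈ T`, then `e ^ m u` is a nonzero multiple of `v`,
and `f` regenerates the whole chain from `v`. -/
theorem eq_span_pow_f_of_stable (hf : h * f - f * h = (-2 : ℂ) • f) (hef : e * f - f * e = h)
    (hv : h v = (n : ℂ) • v) (he : e v = 0) {T : Submodule ℂ V}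
    (hT : T ≤ Submodule.span ℂ ((fun k => (f ^ k) v) '' Set.Iio (n + 1))) (hT0 : T ≠ ⊥)
    (hTe : ∀ w ∈ T, e w ∈ T) (hTf : ∀ w ∈ T, f w ∈ T) :
    T = Submodule.span ℂ ((fun k => (f ^ k) v) '' Set.Iio (n + 1)) := by
  have hpow : ∀ g : Module.End ℂ V, (∀ w ∈ T, g w ∈ T) → ∀ k, ∀ w ∈ T, (g ^ k) w ∈ T := by
    intro g hg k
    induction k with
    | zero => simp
    | succ k ih => intro w hw; rw [pow_succ', Module.End.mul_apply]; exact hg _ (ih w hw)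
  obtain ⟨u, huT, hu0⟩ := Submodule.exists_mem_ne_zero_of_ne_bot hT0
  -- The induction on `m` locates the top term of `u` with nonzero coefficient.
  have key : ∀ m ≤ n + 1, u ∈ Submodule.span ℂ ((fun k => (f ^ k) v) '' Set.Iio m) → v ∈ T := by
    intro m
    induction m with
    | zero =>
      intro _ hu
      exact absurd (by simpa using hu) hu0
    | succ m ih =>
      intro hm hu
      have hset : Set.Iio (m + 1) = insert m (Set.Iio m) := by
        ext k; simp only [Set.mem_Iio, Set.mem_insert_iff]; omega
      rw [hset, Set.image_insert_eq] at hu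
      obtain ⟨c, z, hz, rfl⟩ := Submodule.mem_span_insert.1 hu
      obtain ⟨⟨d, hd, h1⟩, h2⟩ := exists_pow_e_pow_f hf hef hv he (show m ≤ n by omega)
      by_cases hc : c = 0
      · refine ih (by omega) ?_
        simpa [hc] using hz
      · have hz0 : (e ^ m) z = 0 := by
          have : Submodule.span ℂ ((fun k => (f ^ k) v) '' Set.Iio m) ≤ LinearMap.ker (e ^ m) :=
            Submodule.span_le.2 (by rintro _ ⟨k, hk, rfl⟩; exact h2 k hk)
          exact this hz
        have h3 := hpow e hTe m _ huT
        rw [map_add, map_smul, hz0, add_zero, h1, smul_smul] at h3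
        exact (Submodule.smul_mem_iff _ (mul_ne_zero hc hd)).1 h3
  have hvT := key (n + 1) le_rfl (hT huT)
  refine le_antisymm hT (Submodule.span_le.2 ?_)
  rintro _ ⟨k, _, rfl⟩
  exact hpow f hTf k v hvT

end HighestWeight

/-! ### The infinitesimal action -/

section SiteOperators

variable {N : ℕ}

/-- The operator `h₀ ⊗ h₁ ⊗ ⋯` on `(ℂ²)^{⊗ N}`. -/
noncomputable def tensorOp (N : ℕ) :
    (Fin N → Matrix (Fin 2) (Fin 2) ℂ) →* Module.End ℂ (Qubits N) where
  toFun h := Matrix.toEuclideanLin (Matrix.of fun x y : Fin N → Fin 2 => ∏ i, h i (x i) (y i))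
  map_one' := by
    have : (Matrix.of fun x y : Fin N → Fin 2 =>
        ∏ i, (1 : Fin N → Matrix (Fin 2) (Fin 2) ℂ) i (x i) (y i)) = 1 := by
      ext x y
      simp only [Matrix.of_apply, Pi.one_apply, Matrix.one_apply]
      rw [Fintype.prod_ite_zero]
      simp [funext_iff]
    rw [this]
    exact Matrix.toLpLin_one 2
  map_mul' h h' := by
    refine Eq.trans ?_ (Matrix.toLpLin_mul_same 2 _ _)
    congr 1
    ext x y
    simp only [Matrix.of_apply, Pi.mul_apply, Matrix.mul_apply, Finset.prod_univ_sum,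
      Fintype.piFinset_univ, Finset.prod_mul_distrib]

theorem tensorOp_const (g : Matrix (Fin 2) (Fin 2) ℂ) :
    tensorOp N (fun _ => g) = tensorPower N g := rfl

theorem tensorOp_apply (h : Fin N → Matrix (Fin 2) (Fin 2) ℂ) (v : Qubits N) (x : Fin N → Fin 2) :
    tensorOp N h v x = ∑ y, (∏ i, h i (x i) (y i)) * v y := rfl

theorem tensorOp_mulSingle_apply (i : Fin N) (X : Matrix (Fin 2) (Fin 2) ℂ) (v : Qubits N)
    (x : Fin N → Fin 2) :
    tensorOp N (Pi.mulSingle i X) v x = ∑ b, X (x i) b * v (Function.update x i b) := by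
  rw [tensorOp_apply]
  refine (Finset.sum_of_injOn (fun b => Function.update x i b)
    (Function.update_injective x i).injOn (by simp) (fun y _ hy => ?_) fun b _ => ?_).symm
  · have : ∃ k, k ≠ i ∧ x k ≠ y k := by
      by_contra! hc
      refine hy ⟨y i, by simp, ?_⟩
      funext k
      by_cases hk : k = i
      · subst hk; simp
      · simp [Function.update_of_ne hk, hc k hk]
    obtain ⟨k, hk, hxy⟩ := this
    rw [Finset.prod_eq_zero (Finset.mem_univ k), zero_mul]
    simp [Pi.mulSingle_eq_of_ne hk, hxy]
  · congr 1
    rw [← Finset.mul_prod_erase _ _ (Finset.mem_univ i), Finset.prod_eq_one, mul_one]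
    · simp
    · intro k hk
      have hk' := Finset.ne_of_mem_erase hk
      simp [Pi.mulSingle_eq_of_ne hk', Function.update_of_ne hk']

/-- The derivative of `g ↦ g^{⊗ N}` at the identity. -/
noncomputable def siteSum (N : ℕ) : Matrix (Fin 2) (Fin 2) ℂ →ₗ[ℂ] Module.End ℂ (Qubits N) where
  toFun X := ∑ i, tensorOp N (Pi.mulSingle i X)
  map_add' X Y := by
    ext v x
    simp only [LinearMap.sum_apply, LinearMap.add_apply, WithLp.ofLp_sum, Finset.sum_apply,
      WithLp.ofLp_add, Pi.add_apply, tensorOp_mulSingle_apply, Matrix.add_apply, add_mul,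
      Finset.sum_add_distrib]
  map_smul' c X := by
    ext v x
    simp only [LinearMap.sum_apply, LinearMap.smul_apply, WithLp.ofLp_sum, Finset.sum_apply,
      WithLp.ofLp_smul, Pi.smul_apply, tensorOp_mulSingle_apply, Matrix.smul_apply, smul_eq_mul,
      Finset.mul_sum, mul_assoc, RingHom.id_apply]

theorem siteSum_eq_sum (X : Matrix (Fin 2) (Fin 2) ℂ) :
    siteSum N X = ∑ i, tensorOp N (Pi.mulSingle i X) := rfl

theorem siteSum_apply (X : Matrix (Fin 2) (Fin 2) ℂ) (v : Qubits N) (x : Fin N → Fin 2) :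
    siteSum N X v x = ∑ i, ∑ b, X (x i) b * v (Function.update x i b) := by
  simp only [siteSum_eq_sum, LinearMap.sum_apply, WithLp.ofLp_sum, Finset.sum_apply,
    tensorOp_mulSingle_apply]

theorem siteSum_one : siteSum N 1 = (N : ℂ) • 1 := by
  simp only [siteSum_eq_sum, Pi.mulSingle_one, map_one, Finset.sum_const, Finset.card_univ,
    Fintype.card_fin, Nat.cast_smul_eq_nsmul]

theorem mulSingle_mul_comm {i k : Fin N} (h : i ≠ k) (X Y : Matrix (Fin 2) (Fin 2) ℂ) :
    (Pi.mulSingle i X * Pi.mulSingle k Y : Fin N → Matrix (Fin 2) (Fin 2) ℂ) =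
      Pi.mulSingle k Y * Pi.mulSingle i X :=
  (Pi.mulSingle_commute (f := fun _ : Fin N => Matrix (Fin 2) (Fin 2) ℂ) h X Y).eq

/-- Operators at different sites commute, so only the diagonal of the double sum survives. -/
theorem siteSum_commutator (X Y : Matrix (Fin 2) (Fin 2) ℂ) :
    siteSum N X * siteSum N Y - siteSum N Y * siteSum N X = siteSum N (X * Y - Y * X) := by
  have h1 : siteSum N Y * siteSum N X =
      ∑ i, ∑ k, tensorOp N (Pi.mulSingle k Y) * tensorOp N (Pi.mulSingle i X) := by
    rw [siteSum_eq_sum, siteSum_eq_sum, Finset.sum_mul_sum, Finset.sum_comm]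
  rw [h1, map_sub, siteSum_eq_sum X, siteSum_eq_sum Y, Finset.sum_mul_sum, siteSum_eq_sum,
    siteSum_eq_sum, ← Finset.sum_sub_distrib, ← Finset.sum_sub_distrib]
  refine Finset.sum_congr rfl fun i _ => ?_
  rw [← Finset.sum_sub_distrib, Finset.sum_eq_single i]
  · rw [← map_mul, ← map_mul, ← Pi.mulSingle_mul, ← Pi.mulSingle_mul]
  · intro k _ hk
    rw [← map_mul, ← map_mul, mulSingle_mul_comm hk.symm, sub_self]
  · simp

open MvPolynomial in
/-- A subspace stable under the infinitesimal action is stable under `g^{⊗ N}`: the elementary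
symmetric functions of the `N` commuting site operators are polynomials in their power sums. -/
theorem tensorPower_mem_of_siteSum_mem {S : Submodule ℂ (Qubits N)}
    (hS : ∀ X, ∀ v ∈ S, siteSum N X v ∈ S) (g : Matrix (Fin 2) (Fin 2) ℂ) {v : Qubits N}
    (hv : v ∈ S) : tensorPower N g v ∈ S := by
  let s : Fin N → Module.End ℂ (Qubits N) := fun i => tensorOp N (Pi.mulSingle i g)
  have hcomm : ∀ i k, s i * s k = s k * s i := fun i k => by
    by_cases hik : i = k
    · rw [hik]
    · simp only [s, ← map_mul, mulSingle_mul_comm hik]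
  -- Multivariate polynomials are evaluated in the commutative subalgebra generated by the site
  -- operators.
  have : IsMulCommutative (Algebra.adjoin ℂ (Set.range s)) :=
    Algebra.isMulCommutative_adjoin ℂ (by rintro _ ⟨i, rfl⟩ _ ⟨k, rfl⟩; exact hcomm i k)
  open scoped IsMulCommutative in
  let a : Fin N → Algebra.adjoin ℂ (Set.range s) := fun i =>
    ⟨s i, Algebra.subset_adjoin ⟨i, rfl⟩⟩
  let φ : MvPolynomial (Fin N) ℂ →ₐ[ℂ] Module.End ℂ (Qubits N) :=
    (Algebra.adjoin ℂ (Set.range s)).val.comp (aeval a)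
  have hX : ∀ i, φ (X i) = s i := fun i => by simp [φ, a]
  have hp : ∀ m, φ (psum (Fin N) ℂ m) = siteSum N (g ^ m) := fun m => by
    simp only [psum, map_sum, map_pow, hX, s, siteSum_eq_sum]
    refine Finset.sum_congr rfl fun i _ => ?_
    rw [← map_pow, Pi.mulSingle_pow]
  have he : ∀ k, ∀ v ∈ S, φ (esymm (Fin N) ℂ k) v ∈ S := by
    intro k
    induction k using Nat.strong_induction_on with
    | _ k ih =>
      intro v hv
      rcases Nat.eq_zero_or_pos k with rfl | hk
      · simpa using hv
      · have hN := congrArg φ (mul_esymm_eq_sum (Fin N) ℂ k)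
        have hk0 : (k : ℂ) ≠ 0 := by exact_mod_cast hk.ne'
        rw [← Submodule.smul_mem_iff S hk0]
        have h1 : (k : ℂ) • φ (esymm (Fin N) ℂ k) v = φ (k * esymm (Fin N) ℂ k) v := by
          rw [map_mul, map_natCast, Module.End.mul_apply]
          simp [Nat.cast_smul_eq_nsmul]
        have hsign : ∀ (m : ℕ) (w : Qubits N), w ∈ S → φ ((-1) ^ m) w ∈ S := by
          intro m w hw
          rcases neg_one_pow_eq_or (MvPolynomial (Fin N) ℂ) m with h | h
          · rw [h]; simpa using hw
          · rw [h]; simpa using hw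
        rw [h1, hN, map_mul, Module.End.mul_apply]
        refine hsign _ _ ?_
        rw [map_sum, LinearMap.sum_apply]
        refine S.sum_mem fun p hp' => ?_
        rw [map_mul, map_mul, Module.End.mul_apply, Module.End.mul_apply, hp]
        exact hsign _ _ (ih _ (Finset.mem_filter.1 hp').2 _ (hS _ _ hv))
  have hprod : φ (esymm (Fin N) ℂ N) = tensorPower N g := by
    have h1 : esymm (Fin N) ℂ N = ∏ i, X i := by
      have h2 := Finset.powersetCard_self (Finset.univ : Finset (Fin N))
      rw [Finset.card_univ, Fintype.card_fin] at h2
      rw [esymm, h2, Finset.sum_singleton]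
    have hR : tensorOp N (fun _ => g) = Finset.univ.noncommProd s fun i _ k _ _ => hcomm i k := by
      conv_lhs => rw [← Finset.noncommProd_mulSingle (fun _ : Fin N => g)]
      exact Finset.map_noncommProd _ _ _ (tensorOp N)
    rw [h1, ← tensorOp_const, hR, ← Finset.noncommProd_eq_prod]
    exact (Finset.map_noncommProd _ _ _ φ).trans
      (Finset.noncommProd_congr rfl (fun i _ => hX i) _)
  rw [← hprod]
  exact he N v hv

theorem hasDerivAt_inner_tensorPower (w v : Qubits N) {g : ℝ → Matrix (Fin 2) (Fin 2) ℂ}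
    {X : Matrix (Fin 2) (Fin 2) ℂ} (h1 : g 0 = 1)
    (hg : ∀ a b, HasDerivAt (fun t => g t a b) (X a b) 0) :
    HasDerivAt (fun t => inner ℂ w (tensorPower N (g t) v)) (inner ℂ w (siteSum N X v)) 0 := by
  have hE : ∀ x y : Fin N → Fin 2, HasDerivAt (fun t => ∏ i, g t (x i) (y i))
      (∑ i, ∏ k, (Pi.mulSingle i X : Fin N → Matrix (Fin 2) (Fin 2) ℂ) k (x k) (y k)) 0 := by
    intro x y
    have := HasDerivAt.fun_finsetProd (u := Finset.univ) (x := (0 : ℝ))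
      (f := fun i t => g t (x i) (y i)) (f' := fun i => X (x i) (y i)) fun i _ => hg (x i) (y i)
    refine this.congr_deriv (Finset.sum_congr rfl fun i _ => ?_)
    rw [← Finset.mul_prod_erase _ _ (Finset.mem_univ i), smul_eq_mul, mul_comm, h1]
    congr 1
    · simp
    · refine Finset.prod_congr rfl fun k hk => ?_
      rw [Pi.mulSingle_eq_of_ne (Finset.ne_of_mem_erase hk)]
  have hin : ∀ u : Qubits N, inner ℂ w u = ∑ x, u x * star (w x) := fun u => by
    simp [PiLp.inner_apply]
  simp only [hin]
  refine HasDerivAt.fun_sum fun x _ => HasDerivAt.mul_const ?_ _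
  have h2 : siteSum N X v x = ∑ y, (∑ i, ∏ k,
      (Pi.mulSingle i X : Fin N → Matrix (Fin 2) (Fin 2) ℂ) k (x k) (y k)) * v y := by
    simp only [siteSum_eq_sum, LinearMap.sum_apply, WithLp.ofLp_sum, Finset.sum_apply,
      tensorOp_apply, Finset.sum_mul]
    rw [Finset.sum_comm]
  rw [h2]
  simp only [← tensorOp_const, tensorOp_apply]
  exact HasDerivAt.fun_sum fun y _ => (hE x y).mul_const _

/-- Tested against `w ∈ Tᗮ`, the orbit of `v` gives a scalar function that vanishes identically. Its
derivative is zero, so the velocity lies in `Tᗮᗮ = T`. -/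
theorem siteSum_mem_of_isInvariant {T : Submodule ℂ (Qubits N)} (hT : IsInvariant T)
    {g : ℝ → Matrix (Fin 2) (Fin 2) ℂ} {X : Matrix (Fin 2) (Fin 2) ℂ}
    (hgU : ∀ t, g t ∈ Matrix.specialUnitaryGroup (Fin 2) ℂ) (h1 : g 0 = 1)
    (hg : ∀ a b, HasDerivAt (fun t => g t a b) (X a b) 0) {v : Qubits N} (hv : v ∈ T) :
    siteSum N X v ∈ T := by
  rw [← Submodule.orthogonal_orthogonal T]
  intro w hw
  have h2 := hasDerivAt_inner_tensorPower w v h1 hg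
  have h3 : (fun t => inner ℂ w (tensorPower N (g t) v)) = fun _ => (0 : ℂ) := by
    funext t
    exact (Submodule.mem_orthogonal' _ _).1 hw _ (hT _ (hgU t) v hv)
  rw [h3] at h2
  exact h2.unique (hasDerivAt_const _ _)

theorem mem_specialUnitaryGroup_of_normSq {a b : ℂ} (h : Complex.normSq a + Complex.normSq b = 1) :
    !![a, -star b; b, star a] ∈ Matrix.specialUnitaryGroup (Fin 2) ℂ := by
  have h' : star a * a + star b * b = 1 := by
    have := congrArg (fun r : ℝ => (r : ℂ)) h
    simpa [Complex.normSq_eq_conj_mul_self] using this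
  rw [Matrix.mem_specialUnitaryGroup_iff, Matrix.mem_unitaryGroup_iff']
  constructor
  · ext i j
    fin_cases i <;> fin_cases j <;>
      simp [Matrix.mul_apply, Fin.sum_univ_two, Matrix.star_apply] <;>
      simp at h' <;> first | linear_combination h' | ring
  · rw [Matrix.det_fin_two_of]
    linear_combination h'

/-- The infinitesimal action preserves the subrepresentations of `SU(2)`. -/
theorem IsInvariant.siteSum_mem {T : Submodule ℂ (Qubits N)} (hT : IsInvariant T)
    {v : Qubits N} (hv : v ∈ T) :
    siteSum N !![0, 1; 0, 0] v ∈ T ∧ siteSum N !![0, 0; 1, 0] v ∈ T := by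
  have hc : HasDerivAt (fun t : ℝ => (Real.cos t : ℂ)) 0 0 := by
    simpa using (Real.hasDerivAt_cos 0).ofReal_comp
  have hs : HasDerivAt (fun t : ℝ => (Real.sin t : ℂ)) 1 0 := by
    simpa using (Real.hasDerivAt_sin 0).ofReal_comp
  have hcs : ∀ t : ℝ, Real.cos t * Real.cos t + Real.sin t * Real.sin t = 1 := fun t => by
    rw [← sq, ← sq, Real.cos_sq_add_sin_sq]
  -- Two curves in `SU(2)` have velocities whose complex combinations are the raising and lowering
  -- matrices.
  have h1 : siteSum N !![0, -1; 1, 0] v ∈ T := by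
    refine siteSum_mem_of_isInvariant hT
      (g := fun t => !![(Real.cos t : ℂ), -star (Real.sin t : ℂ); (Real.sin t : ℂ),
        star (Real.cos t : ℂ)])
      (fun t => mem_specialUnitaryGroup_of_normSq (by
        simp only [Complex.normSq_ofReal]; exact hcs t)) ?_
      (fun a b => ?_) hv
    · ext a b; fin_cases a <;> fin_cases b <;> simp
    · fin_cases a <;> fin_cases b <;>
        simp only [Fin.zero_eta, Fin.mk_one, Matrix.of_apply, Matrix.cons_val', Matrix.cons_val_zero,
          Matrix.cons_val_one, Matrix.cons_val_fin_one, RCLike.star_def, Complex.conj_ofReal]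
      · exact hc
      · exact hs.neg
      · exact hs
      · exact hc
  have h2 : siteSum N !![0, Complex.I; Complex.I, 0] v ∈ T := by
    refine siteSum_mem_of_isInvariant hT
      (g := fun t => !![(Real.cos t : ℂ), -star (Complex.I * Real.sin t : ℂ);
        Complex.I * (Real.sin t : ℂ), star (Real.cos t : ℂ)])
      (fun t => mem_specialUnitaryGroup_of_normSq (by
        simp only [map_mul, Complex.normSq_ofReal, Complex.normSq_I, one_mul]; exact hcs t)) ?_
      (fun a b => ?_) hv
    · ext a b; fin_cases a <;> fin_cases b <;> simp
    · have hIs : HasDerivAt (fun t : ℝ => Complex.I * (Real.sin t : ℂ)) Complex.I 0 := by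
        simpa using hs.const_mul Complex.I
      fin_cases a <;> fin_cases b <;>
        simp only [Fin.zero_eta, Fin.mk_one, Matrix.of_apply, Matrix.cons_val', Matrix.cons_val_zero,
          Matrix.cons_val_one, Matrix.cons_val_fin_one, RCLike.star_def, Complex.conj_ofReal,
          map_mul, Complex.conj_I, neg_mul, neg_neg]
      · exact hc
      · exact hIs
      · exact hIs
      · exact hc
  have he : !![0, 1; 0, 0] = (-(1 / 2) : ℂ) • !![(0 : ℂ), -1; 1, 0] +
      (-(Complex.I / 2)) • !![0, Complex.I; Complex.I, 0] := by
    ext a b; fin_cases a <;> fin_cases b <;> simp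
    · linear_combination (1 / 2 : ℂ) * Complex.I_mul_I
    · linear_combination (1 / 2 : ℂ) * Complex.I_mul_I
  have hf : !![0, 0; 1, 0] = (1 / 2 : ℂ) • !![(0 : ℂ), -1; 1, 0] +
      (-(Complex.I / 2)) • !![0, Complex.I; Complex.I, 0] := by
    ext a b; fin_cases a <;> fin_cases b <;> simp
    · linear_combination (1 / 2 : ℂ) * Complex.I_mul_I
    · linear_combination (1 / 2 : ℂ) * Complex.I_mul_I
  rw [he, hf, map_add, map_add, map_smul, map_smul, map_smul, LinearMap.add_apply,
    LinearMap.add_apply, LinearMap.smul_apply, LinearMap.smul_apply, LinearMap.smul_apply]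
  exact ⟨T.add_mem (T.smul_mem _ h1) (T.smul_mem _ h2),
    T.add_mem (T.smul_mem _ h1) (T.smul_mem _ h2)⟩

end SiteOperators

/-! ### Lower bounds on the dimension of a block -/

section BlockDim

variable {N : ℕ}

/-- The number of ones of a computational basis state. -/
def ones (x : Fin N → Fin 2) : ℕ := (Finset.univ.filter fun i => x i = 1).card

/-- The vectors supported on the computational basis states with `k` ones. -/
def weightSpace (N k : ℕ) : Submodule ℂ (Qubits N) where
  carrier := {v | ∀ x, ones x ≠ k → v x = 0}
  add_mem' ha hb x hx := by simp [ha x hx, hb x hx]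
  zero_mem' x _ := rfl
  smul_mem' c v hv x hx := by simp [hv x hx]

theorem siteSum_lower_commutator :
    siteSum N !![1, 0; 0, -1] * siteSum N !![0, 0; 1, 0] -
      siteSum N !![0, 0; 1, 0] * siteSum N !![1, 0; 0, -1] =
      (-2 : ℂ) • siteSum N !![0, 0; 1, 0] := by
  rw [siteSum_commutator, ← map_smul]
  congr 1
  ext a b; fin_cases a <;> fin_cases b <;> simp; norm_num

theorem siteSum_raise_commutator :
    siteSum N !![0, 1; 0, 0] * siteSum N !![0, 0; 1, 0] -
      siteSum N !![0, 0; 1, 0] * siteSum N !![0, 1; 0, 0] = siteSum N !![1, 0; 0, -1] := by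
  rw [siteSum_commutator]
  congr 1
  ext a b; fin_cases a <;> fin_cases b <;> simp

theorem siteSum_diag_apply {k : ℕ} {v : Qubits N} (hv : v ∈ weightSpace N k) :
    siteSum N !![1, 0; 0, -1] v = ((N : ℂ) - 2 * k) • v := by
  ext x
  rw [siteSum_apply]
  have h1 : ∀ i, ∑ b, (!![1, 0; 0, -1] : Matrix (Fin 2) (Fin 2) ℂ) (x i) b *
      v (Function.update x i b) = (1 - 2 * if x i = 1 then 1 else 0) * v x := by
    intro i
    rw [Finset.sum_eq_single (x i)]
    · rw [Function.update_eq_self]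
      congr 1
      generalize x i = c
      fin_cases c <;> simp; norm_num
    · intro b _ hb
      generalize x i = c at *
      fin_cases c <;> fin_cases b <;> simp_all
    · simp
  simp only [h1, ← Finset.sum_mul, Finset.sum_sub_distrib, ← Finset.mul_sum, Finset.sum_boole]
  by_cases hx : ones x = k
  · simp [← hx, ones]
  · simp [hv x hx]

/-- Every highest weight vector of weight `N - 2 j` lies in the block of `(N - j, j)`, and spans an
irreducible subrepresentation. -/
theorem exists_isIrreducible (j : Fin (N / 2 + 1)) {v : Qubits N} (hv : v ∈ weightSpace N j)
    (he : siteSum N !![0, 1; 0, 0] v = 0) (hv0 : v ≠ 0) :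
    ∃ S : Submodule ℂ (Qubits N), IsIrreducible S ∧
      Module.finrank ℂ S = N - 2 * (j : ℕ) + 1 ∧ v ∈ S := by
  have hj := j.2
  -- As `2 j ≤ N`, the truncated difference `N - 2 j` is the true weight.
  have hh : siteSum N !![1, 0; 0, -1] v = ((N - 2 * (j : ℕ) : ℕ) : ℂ) • v := by
    rw [siteSum_diag_apply hv, Nat.cast_sub (by omega)]
    push_cast
    rfl
  have hf := siteSum_lower_commutator (N := N)
  have hef := siteSum_raise_commutator (N := N)
  refine ⟨_, ⟨?_, ?_, fun T hT hTi => ?_⟩, finrank_span_pow_f hf hef hh he hv0, ?_⟩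
  · intro g _ w hw
    refine tensorPower_mem_of_siteSum_mem (fun X w hw => ?_) g hw
    obtain ⟨h1, h2, h3⟩ := span_pow_f_stable hf hef hh he hw
    -- The identity, which complements the `sl₂` triple to a basis of all matrices, acts by the
    -- scalar `N`.
    have hX : X = X 0 1 • !![0, 1; 0, 0] + X 1 0 • !![0, 0; 1, 0] +
        ((X 0 0 - X 1 1) / 2) • !![1, 0; 0, -1] + ((X 0 0 + X 1 1) / 2) • 1 := by
      ext a b; fin_cases a <;> fin_cases b <;> simp <;> ring
    rw [hX]
    simp only [map_add, map_smul, siteSum_one, LinearMap.add_apply, LinearMap.smul_apply,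
      Module.End.one_apply]
    exact Submodule.add_mem _ (Submodule.add_mem _ (Submodule.add_mem _
      (Submodule.smul_mem _ _ h1) (Submodule.smul_mem _ _ h2)) (Submodule.smul_mem _ _ h3))
      (Submodule.smul_mem _ _ (Submodule.smul_mem _ _ hw))
  · intro h0
    have := finrank_span_pow_f hf hef hh he hv0
    rw [h0, finrank_bot] at this
    omega
  · by_cases hT0 : T = ⊥
    · exact Or.inl hT0
    · exact Or.inr (eq_span_pow_f_of_stable hf hef hh he hT hT0
        (fun w hw => (hTi.siteSum_mem hw).1) fun w hw => (hTi.siteSum_mem hw).2)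
  · exact Submodule.subset_span ⟨0, by simp, by simp⟩

theorem ones_update_one {x : Fin N → Fin 2} {i : Fin N} (h : x i = 0) :
    ones (Function.update x i 1) = ones x + 1 := by
  have : (Finset.univ.filter fun k => Function.update x i 1 k = 1) =
      insert i (Finset.univ.filter fun k => x k = 1) := by
    ext k
    by_cases hk : k = i
    · subst hk; simp
    · simp [hk]
  rw [ones, this, Finset.card_insert_of_notMem (by simp [h]), ones]

theorem siteSum_raise_mem {k : ℕ} {v : Qubits N} (hv : v ∈ weightSpace N (k + 1)) :
    siteSum N !![0, 1; 0, 0] v ∈ weightSpace N k := by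
  intro x hx
  rw [siteSum_apply]
  refine Finset.sum_eq_zero fun i _ => Finset.sum_eq_zero fun b _ => ?_
  by_cases h : x i = 0 ∧ b = 1
  · rw [hv, mul_zero]
    rw [h.2, ones_update_one h.1]
    omega
  · generalize x i = c at *
    fin_cases c <;> fin_cases b <;> simp_all

theorem card_ones_eq (N k : ℕ) : Fintype.card {x : Fin N → Fin 2 // ones x = k} = N.choose k := by
  have h := Fintype.card_finset_len (α := Fin N) k
  rw [Fintype.card_fin] at h
  rw [← h]
  let e : (Fin N → Fin 2) ≃ Finset (Fin N) :=
    { toFun := fun x => Finset.univ.filter fun i => x i = 1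
      invFun := fun s i => if i ∈ s then 1 else 0
      left_inv := fun x => by
        funext i
        simp only [Finset.mem_filter, Finset.mem_univ, true_and]
        generalize x i = c
        fin_cases c <;> simp
      right_inv := fun s => by
        ext i
        simp }
  exact Fintype.card_congr (e.subtypeEquiv fun x => Iff.rfl)

theorem finrank_weightSpace (N k : ℕ) : Module.finrank ℂ (weightSpace N k) = N.choose k := by
  rw [← card_ones_eq, ← Module.finrank_fintype_fun_eq_card ℂ]
  refine LinearEquiv.finrank_eq
    { toFun := fun v x => v.1 x
      map_add' := fun v w => rfl
      map_smul' := fun c v => rfl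
      invFun := fun a => ⟨WithLp.toLp 2 fun x => if h : ones x = k then a ⟨x, h⟩ else 0,
        fun x hx => by simp [hx]⟩
      left_inv := fun v => by
        ext x
        by_cases hx : ones x = k
        · simp [hx]
        · simp [hx, v.2 x hx]
      right_inv := fun a => by
        funext x
        simp [x.2] }

/-- Rank–nullity for the raising operator from `k + 1` ones to `k` ones: the nonzero vectors of its
kernel are highest weight vectors, which lie in the block. -/
theorem choose_le_blockDim_add (j : Fin (N / 2 + 1)) {k : ℕ} (hj : (j : ℕ) = k + 1) :
    N.choose (k + 1) ≤ blockDim N j + N.choose k := by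
  let g := (siteSum N !![0, 1; 0, 0]).domRestrict (weightSpace N (k + 1))
  have h1 := LinearMap.finrank_range_add_finrank_ker g
  have h2 : Module.finrank ℂ (LinearMap.range g) ≤ N.choose k := by
    rw [← finrank_weightSpace]
    refine Submodule.finrank_mono ?_
    rintro _ ⟨v, rfl⟩
    exact siteSum_raise_mem v.2
  have h3 : Module.finrank ℂ (LinearMap.ker g) ≤ blockDim N j := by
    rw [← Submodule.finrank_map_subtype_eq]
    refine Submodule.finrank_mono ?_
    rintro _ ⟨v, hv, rfl⟩
    by_cases hv0 : (v : Qubits N) = 0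
    · simp [hv0]
    · have hvj : (v : Qubits N) ∈ weightSpace N j := by rw [hj]; exact v.2
      obtain ⟨S, hS, hS2, hvS⟩ := exists_isIrreducible j hvj hv hv0
      exact (le_sSup (show S ∈ {S | IsIrreducible S ∧
        Module.finrank ℂ S = N - 2 * (j : ℕ) + 1} from ⟨hS, hS2⟩)) hvS
  rw [finrank_weightSpace] at h1
  omega

/-- The state `|0…0⟩` is a highest weight vector of weight `N`. -/
theorem succ_le_blockDim_zero (N : ℕ) : N + 1 ≤ blockDim N 0 := by
  let v : Qubits N := EuclideanSpace.single 0 1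
  have hv0 : v ≠ 0 := by simp [v]
  have hv : v ∈ weightSpace N ((0 : Fin (N / 2 + 1)) : ℕ) := by
    intro x hx
    have : x ≠ 0 := by
      rintro rfl
      simp [ones] at hx
    simp [v, this]
  have he : siteSum N !![0, 1; 0, 0] v = 0 := by
    ext x
    rw [siteSum_apply]
    refine Finset.sum_eq_zero fun i _ => Finset.sum_eq_zero fun b _ => ?_
    by_cases hb : b = 0
    · subst hb
      generalize x i = c
      fin_cases c <;> simp
    · have : Function.update x i b ≠ 0 := fun h => hb (by simpa using congrFun h i)
      simp [v, this]
  obtain ⟨S, hS, hS2, -⟩ := exists_isIrreducible 0 hv he hv0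
  have h := Submodule.finrank_mono (le_sSup (show S ∈ {S | IsIrreducible S ∧
    Module.finrank ℂ S = N - 2 * ((0 : Fin (N / 2 + 1)) : ℕ) + 1} from ⟨hS, hS2⟩))
  rw [hS2] at h
  exact h

end BlockDim

/-! ### Growth of the block dimensions. -/

section Growth

variable {N : ℕ}

theorem choose_le_choose_of_le_half {i j : ℕ} (hij : i ≤ j) (hj : j ≤ N / 2) :
    N.choose i ≤ N.choose j := by
  induction j, hij using Nat.le_induction with
  | base => exact le_rfl
  | succ j _ ih => exact (ih (by omega)).trans (Nat.choose_le_succ_of_lt_half_left (by omega))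

/-- Since `(N - k) C(N, k) = (k + 1) C(N, k + 1)`, this is the previous lower bound for `D`,
multiplied by `N - k`. The factor `N - 2 k - 1` is positive because `k + 1 ≤ N / 2`. -/
theorem choose_mul_le_mul_blockDim (j : Fin (N / 2 + 1)) {k : ℕ} (hj : (j : ℕ) = k + 1) :
    N.choose (k + 1) * (N - 2 * k - 1) ≤ (N - k) * blockDim N j := by
  have h1 := choose_le_blockDim_add j hj
  have h2 := Nat.choose_succ_right_eq N k
  have hjN := j.2
  obtain ⟨m, hm⟩ : ∃ m, N = 2 * k + 1 + m := ⟨N - (2 * k + 1), by omega⟩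
  rw [show N - 2 * k - 1 = m by omega]
  rw [show N - k = k + 1 + m by omega] at h2 ⊢
  nlinarith [Nat.mul_le_mul_left (k + 1 + m) h1]

theorem choose_le_mul_blockDim (j : Fin (N / 2 + 1)) :
    N.choose j ≤ (N + 1) * blockDim N j := by
  rcases Nat.eq_zero_or_pos (j : ℕ) with h | h
  · have hj : j = 0 := Fin.ext h
    have := succ_le_blockDim_zero N
    subst hj
    rw [h, Nat.choose_zero_right]
    nlinarith
  · obtain ⟨k, hk⟩ := Nat.exists_eq_add_of_lt h
    have hk' : (j : ℕ) = k + 1 := by omega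
    have h1 := choose_mul_le_mul_blockDim j hk'
    have := j.2
    rw [hk']
    calc N.choose (k + 1) ≤ N.choose (k + 1) * (N - 2 * k - 1) :=
          Nat.le_mul_of_pos_right _ (by omega)
      _ ≤ (N - k) * blockDim N j := h1
      _ ≤ (N + 1) * blockDim N j := Nat.mul_le_mul_right _ (by omega)

/-- `D ≥ N + 1` for `j = 0`; `D ≥ N - 1` with `N ≥ 2` for `j = 1`; for `j ≥ 2`, `N (N - 1) / 2 ≤
C(N, j) ≤ N D` with `N ≥ 4`. The constant `4` covers all three. -/
theorem succ_le_four_mul_blockDim (j : Fin (N / 2 + 1)) : N + 1 ≤ 4 * blockDim N j := by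
  have hjN := j.2
  rcases Nat.lt_or_ge (j : ℕ) 2 with h | h
  · rcases Nat.eq_zero_or_pos (j : ℕ) with h0 | h0
    · have hj : j = 0 := Fin.ext h0
      have := succ_le_blockDim_zero N
      subst hj
      omega
    · have h1 := choose_mul_le_mul_blockDim j (k := 0) (by omega)
      simp only [zero_add, Nat.choose_one_right, mul_zero, Nat.sub_zero] at h1
      have := Nat.le_of_mul_le_mul_left h1 (by omega)
      omega
  · obtain ⟨k, hk⟩ := Nat.exists_eq_add_of_le h
    have h1 := choose_mul_le_mul_blockDim j (k := k + 1) (by omega)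
    have h2 : N.choose 2 ≤ N.choose (k + 1 + 1) :=
      choose_le_choose_of_le_half (by omega) (by omega)
    have h3 : N.choose 2 * 2 = N * (N - 1) := by
      rw [Nat.choose_two_right]
      exact Nat.div_mul_cancel (Nat.even_mul_pred_self N).two_dvd
    have h4 : N * (N - 1) ≤ N * (2 * blockDim N j) := by
      calc N * (N - 1) = N.choose 2 * 2 := h3.symm
        _ ≤ N.choose (k + 1 + 1) * (N - 2 * (k + 1) - 1) * 2 := by
            refine Nat.mul_le_mul_right _ (h2.trans (Nat.le_mul_of_pos_right _ (by omega)))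
        _ ≤ (N - (k + 1)) * blockDim N j * 2 := Nat.mul_le_mul_right _ h1
        _ ≤ N * blockDim N j * 2 :=
            Nat.mul_le_mul_right _ (Nat.mul_le_mul_right _ (Nat.sub_le _ _))
        _ = N * (2 * blockDim N j) := by ring
    have := Nat.le_of_mul_le_mul_left h4 (by omega)
    omega

theorem exists_eval_le (Q : Polynomial ℝ) :
    ∃ M : ℝ, 0 ≤ M ∧ ∀ N : ℕ, Q.eval (N : ℝ) ≤ M * ((N : ℝ) + 1) ^ Q.natDegree := by
  refine ⟨∑ i ∈ Finset.range (Q.natDegree + 1), |Q.coeff i|,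
    Finset.sum_nonneg fun _ _ => abs_nonneg _, fun N => ?_⟩
  rw [Polynomial.eval_eq_sum_range, Finset.sum_mul]
  refine Finset.sum_le_sum fun i hi => ?_
  have hi' : i ≤ Q.natDegree := by
    have := Finset.mem_range.1 hi
    omega
  refine mul_le_mul (le_abs_self _) ?_ (by positivity) (abs_nonneg _)
  exact (pow_le_pow_left₀ (by positivity) (by linarith) i).trans
    (pow_le_pow_right₀ (by linarith [N.cast_nonneg (α := ℝ)]) hi')

/-- Only boundedly many blocks have dimension at most `Q(N)`. -/
theorem exists_card_le (Q : Polynomial ℝ) :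
    ∃ B : ℕ, ∀ (N : ℕ) (H : Finset (Fin (N / 2 + 1))),
      (∀ μ ∈ H, (blockDim N μ : ℝ) ≤ Q.eval (N : ℝ)) → H.card ≤ B := by
  obtain ⟨M, hM, hQ⟩ := exists_eval_le Q
  -- One degree more than `(N + 1) Q(N)`: then `((N + 1) / 2) ^ r / r! ≤ C(N, r) ≤ (N + 1) Q(N)`
  -- forces `N + 1 ≤ b`.
  set r := Q.natDegree + 2 with hr
  set b : ℝ := 2 ^ r * r.factorial * M with hb
  refine ⟨r + ⌈b⌉₊, fun N H hH => ?_⟩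
  -- Either all labels are below `r`, or some label is at least `r` and `N` itself is bounded.
  by_cases hsmall : ∀ μ ∈ H, (μ : ℕ) < r
  · have h1 : H.card ≤ (Finset.range r).card :=
      Finset.card_le_card_of_injOn (fun μ => (μ : ℕ))
        (fun μ hμ => Finset.mem_coe.2 (Finset.mem_range.2 (hsmall μ hμ)))
        (Fin.val_injective.injOn)
    rw [Finset.card_range] at h1
    omega
  · push Not at hsmall
    obtain ⟨μ, hμ, hrμ⟩ := hsmall
    have hμN := μ.2
    have h1 : (((N + 1 - r : ℕ) ^ r : ℕ) : ℝ) ≤ r.factorial * N.choose r := by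
      exact_mod_cast Nat.pow_sub_le_descFactorial N r |>.trans_eq (Nat.descFactorial_eq_factorial_mul_choose N r)
    -- Here `r ≤ μ ≤ N / 2`, hence `2 r ≤ N`.
    have h2 : ((N : ℝ) + 1) / 2 ≤ ((N + 1 - r : ℕ) : ℝ) := by
      rw [div_le_iff₀ two_pos]
      exact_mod_cast (by omega : N + 1 ≤ (N + 1 - r) * 2)
    have h3 : (N.choose r : ℝ) ≤ (N + 1) * blockDim N μ := by
      exact_mod_cast (choose_le_choose_of_le_half hrμ (by omega)).trans (choose_le_mul_blockDim μ)
    have hN : (0 : ℝ) < (N : ℝ) + 1 := by positivity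
    have h4 : (((N : ℝ) + 1) / 2) ^ r ≤
        r.factorial * ((N + 1) * (M * ((N : ℝ) + 1) ^ Q.natDegree)) := by
      calc (((N : ℝ) + 1) / 2) ^ r ≤ ((N + 1 - r : ℕ) : ℝ) ^ r :=
            pow_le_pow_left₀ (by positivity) h2 r
        _ ≤ r.factorial * N.choose r := by exact_mod_cast h1
        _ ≤ _ := by
            refine mul_le_mul_of_nonneg_left (h3.trans ?_) (by positivity)
            exact mul_le_mul_of_nonneg_left ((hH μ hμ).trans (hQ N)) hN.le
    rw [div_pow, div_le_iff₀ (by positivity)] at h4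
    have h5 : ((N : ℝ) + 1) * ((N : ℝ) + 1) ^ (Q.natDegree + 1) ≤
        b * ((N : ℝ) + 1) ^ (Q.natDegree + 1) := by
      calc ((N : ℝ) + 1) * ((N : ℝ) + 1) ^ (Q.natDegree + 1) = ((N : ℝ) + 1) ^ r := by
            rw [hr]; ring
        _ ≤ _ := h4
        _ = b * ((N : ℝ) + 1) ^ (Q.natDegree + 1) := by rw [hb]; ring
    have h6 := le_of_mul_le_mul_right h5 (by positivity)
    have h7 : N + 1 ≤ ⌈b⌉₊ := by
      exact_mod_cast h6.trans (Nat.le_ceil b)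
    have h8 := Finset.card_le_univ H
    rw [Fintype.card_fin] at h8
    omega

end Growth

/-! ### Mean and variance of the gradient. -/

namespace Network

variable {N : ℕ} {H : Finset (Fin (N / 2 + 1))} (A : Network N H) {O : Qubits N →L[ℂ] Qubits N}

theorem differentiable_cost (hO : IsBlockObservable H O) : Differentiable ℝ (A.cost O) := by
  rw [show A.cost O = fun x => ∑ μ, A.costTerm O μ x from funext (A.cost_eq_sum hO)]
  exact Differentiable.fun_sum fun μ _ => A.differentiable_costTerm O μ

theorem abs_cost_le (hO : IsBlockObservable H O) (x : A.Param → ℝ) :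
    |A.cost O x| ≤ H.card * ‖O‖ := by
  rw [A.cost_eq_sum hO]
  refine (Finset.abs_sum_le_sum_abs _ _).trans
    ((Finset.sum_le_sum fun μ _ => A.abs_costTerm_le O μ x).trans ?_)
  simp

theorem isSinusoid_cost_inl (hO : IsBlockObservable H O) (i : Fin (H.card - 1))
    (x : A.Param → ℝ) :
    IsSinusoid (2 : ℕ) fun t => A.cost O (Function.update x (Sum.inl i) t) := by
  simp only [A.cost_eq_sum hO]
  exact IsSinusoid.sum _ fun μ _ => A.isSinusoid_costTerm_inl O μ i x

/-- This spares the gate parameters the loss of a Cauchy–Schwarz sum over blocks and keeps the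
explicit constant `2`. -/
theorem partialCost_inr (hO : IsBlockObservable H O) (μ : H) (l : Fin (A.gates μ))
    (x : A.Param → ℝ) :
    A.partialCost O (Sum.inr ⟨μ, l⟩) x =
      deriv (fun t => A.costTerm O μ (Function.update x (Sum.inr ⟨μ, l⟩) t))
        (x (Sum.inr ⟨μ, l⟩)) := by
  have h : ∀ t, A.cost O (Function.update x (Sum.inr ⟨μ, l⟩) t) =
      A.costTerm O μ (Function.update x (Sum.inr ⟨μ, l⟩) t) +
        ∑ ν ∈ Finset.univ.erase μ, A.costTerm O ν x := fun t => by
    have hne : ∑ ν ∈ Finset.univ.erase μ,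
        A.costTerm O ν (Function.update x (Sum.inr ⟨μ, l⟩) t) =
          ∑ ν ∈ Finset.univ.erase μ, A.costTerm O ν x :=
      Finset.sum_congr rfl fun ν hν =>
        A.costTerm_update_inr_of_ne O (Finset.ne_of_mem_erase hν) l x t
    rw [A.cost_eq_sum hO, ← Finset.add_sum_erase _ _ (Finset.mem_univ μ), hne]
  simp only [partialCost, h, deriv_add_const]

theorem memLp_partialCost (hO : IsBlockObservable H O) (i : A.Param) :
    MemLp (A.partialCost O i) 2 A.law := by
  rcases i with i | ⟨μ, l⟩
  · exact memLp_two_deriv_update two_ne_zero (A.differentiable_cost hO).continuous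
      (A.abs_cost_le hO) (A.isSinusoid_cost_inl hO i)
  · rw [show A.partialCost O (Sum.inr ⟨μ, l⟩) = _ from funext (A.partialCost_inr hO μ l)]
    exact memLp_two_deriv_update one_ne_zero (A.differentiable_costTerm O μ).continuous
      (A.abs_costTerm_le O μ) (A.isSinusoid_costTerm_inr O μ l)

theorem integral_partialCost (hO : IsBlockObservable H O) (i : A.Param) :
    ∫ x, A.partialCost O i x ∂A.law = 0 := by
  rcases i with i | ⟨μ, l⟩
  · exact integral_deriv_update_eq_zero two_ne_zero (A.differentiable_cost hO).continuous
      (A.abs_cost_le hO) (A.isSinusoid_cost_inl hO i)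
  · simp only [A.partialCost_inr hO μ l]
    exact integral_deriv_update_eq_zero one_ne_zero (A.differentiable_costTerm O μ).continuous
      (A.abs_costTerm_le O μ) (A.isSinusoid_costTerm_inr O μ l)

theorem variance_partialCost_le_integral_sq (hO : IsBlockObservable H O) (i : A.Param) :
    variance (A.partialCost O i) A.law ≤ ∫ x, A.partialCost O i x ^ 2 ∂A.law := by
  have : IsProbabilityMeasure A.law := by unfold law; infer_instance
  exact variance_le_expectation_sq (A.memLp_partialCost hO i).aestronglyMeasurable

theorem variance_partialCost_inr_le (hA : A.BlocksAreTwoDesigns) (hO : IsBlockObservable H O)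
    (μ : H) (l : Fin (A.gates μ)) :
    variance (A.partialCost O (Sum.inr ⟨μ, l⟩)) A.law ≤
      2 * ‖O‖ ^ 2 / (H.card * blockDim N μ) := by
  have hL : 0 < H.card := Finset.card_pos.2 ⟨μ, μ.2⟩
  have hL' : (0 : ℝ) < H.card := by exact_mod_cast hL
  have hD : (0 : ℝ) < blockDim N μ := by exact_mod_cast A.blockDim_pos μ
  have h1 : ∫ x, A.partialCost O (Sum.inr ⟨μ, l⟩) x ^ 2 ∂A.law ≤
      ∫ x, A.costTerm O μ x ^ 2 ∂A.law := by
    simp only [A.partialCost_inr hO μ l]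
    refine (integral_deriv_update_sq_le one_ne_zero (A.differentiable_costTerm O μ).continuous
      (A.abs_costTerm_le O μ) (A.isSinusoid_costTerm_inr O μ l)).trans_eq ?_
    rw [Nat.cast_one, one_pow, one_mul, law]
  -- `L < 2 ^ (T + 1)` for `T = Nat.log 2 L`, and `3/8 < 1/2`: the decay with the depth beats the
  -- number of leaves.
  have h2 : (3 / 8 : ℝ) ^ Nat.log 2 H.card ≤ 2 / H.card := by
    rw [le_div_iff₀ hL']
    have h3 : (H.card : ℝ) ≤ 2 ^ (Nat.log 2 H.card + 1) := by
      exact_mod_cast (Nat.lt_pow_succ_log_self one_lt_two H.card).le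
    calc (3 / 8 : ℝ) ^ Nat.log 2 H.card * H.card
        ≤ (3 / 8 : ℝ) ^ Nat.log 2 H.card * 2 ^ (Nat.log 2 H.card + 1) := by gcongr
      _ = (3 / 4 : ℝ) ^ Nat.log 2 H.card * 2 := by
          rw [pow_succ, ← mul_assoc, ← mul_pow]; norm_num
      _ ≤ 1 * 2 := by
          gcongr
          exact pow_le_one₀ (by norm_num) (by norm_num)
      _ = 2 := one_mul 2
  calc variance (A.partialCost O (Sum.inr ⟨μ, l⟩)) A.law
      ≤ (3 / 8) ^ Nat.log 2 H.card * (‖O‖ ^ 2 / (blockDim N μ + 1)) :=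
        (A.variance_partialCost_le_integral_sq hO _).trans
          (h1.trans (A.integral_costTerm_sq_le hA hO μ))
    _ ≤ 2 / H.card * (‖O‖ ^ 2 / blockDim N μ) := by
        gcongr
        linarith
    _ = 2 * ‖O‖ ^ 2 / (H.card * blockDim N μ) := by rw [div_mul_div_comm]

/-- One factor `L` comes from Cauchy–Schwarz, one from summing the blocks with `E[c_μ⁴] ≤ 1`, and
`4` is the squared frequency. The growth in `L` is harmless once `L` is bounded. -/
theorem variance_partialCost_inl_le (hA : A.BlocksAreTwoDesigns) (hO : IsBlockObservable H O)
    (i : Fin (H.card - 1)) {d : ℝ} (hd : 0 < d) (hdD : ∀ μ ∈ H, d ≤ blockDim N μ) :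
    variance (A.partialCost O (Sum.inl i)) A.law ≤ 4 * H.card ^ 2 * ‖O‖ ^ 2 / d := by
  have h1 : ∫ x, A.partialCost O (Sum.inl i) x ^ 2 ∂A.law ≤ 4 * ∫ x, A.cost O x ^ 2 ∂A.law := by
    refine (integral_deriv_update_sq_le two_ne_zero (A.differentiable_cost hO).continuous
      (A.abs_cost_le hO) (A.isSinusoid_cost_inl hO i)).trans_eq ?_
    rw [law]
    norm_num
  have : IsProbabilityMeasure A.law := by unfold law; infer_instance
  have hint : ∀ μ, Integrable (fun x => A.costTerm O μ x ^ 2) A.law := fun μ =>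
    (MemLp.of_bound (A.differentiable_costTerm O μ).continuous.aestronglyMeasurable ‖O‖
      (Filter.Eventually.of_forall (A.abs_costTerm_le O μ))).integrable_sq
  have hintC : Integrable (fun x => A.cost O x ^ 2) A.law :=
    (MemLp.of_bound (A.differentiable_cost hO).continuous.aestronglyMeasurable (H.card * ‖O‖)
      (Filter.Eventually.of_forall (A.abs_cost_le hO))).integrable_sq
  have h2 : ∫ x, A.cost O x ^ 2 ∂A.law ≤ H.card * ∑ μ, ∫ x, A.costTerm O μ x ^ 2 ∂A.law := by
    rw [← integral_finsetSum _ fun μ _ => hint μ, ← integral_const_mul]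
    refine integral_mono hintC ((integrable_finsetSum _ fun μ _ => hint μ).const_mul _) fun x => ?_
    have := sq_sum_le_card_mul_sum_sq (s := (Finset.univ : Finset H))
      (f := fun μ => A.costTerm O μ x)
    rw [Finset.card_univ, Fintype.card_coe] at this
    simpa only [A.cost_eq_sum hO] using this
  have h3 : ∀ μ : H, ∫ x, A.costTerm O μ x ^ 2 ∂A.law ≤ ‖O‖ ^ 2 / d := fun μ => by
    refine (A.integral_costTerm_sq_le hA hO μ).trans ?_
    calc _ ≤ 1 * (‖O‖ ^ 2 / d) := by
          gcongr
          · exact pow_le_one₀ (by norm_num) (by norm_num)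
          · linarith [hdD μ μ.2]
      _ = _ := one_mul _
  have h4 : ∑ μ : H, ∫ x, A.costTerm O μ x ^ 2 ∂A.law ≤ H.card * (‖O‖ ^ 2 / d) := by
    refine (Finset.sum_le_sum fun μ _ => h3 μ).trans_eq ?_
    simp
  calc variance (A.partialCost O (Sum.inl i)) A.law
      ≤ 4 * (H.card * (H.card * (‖O‖ ^ 2 / d))) := by
        refine (A.variance_partialCost_le_integral_sq hO _).trans (h1.trans ?_)
        refine mul_le_mul_of_nonneg_left (h2.trans ?_) (by norm_num)
        exact mul_le_mul_of_nonneg_left h4 (by positivity)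
    _ = _ := by ring

end Network

end LCQNN

theorem corollary4 (Q : Polynomial ℝ) :
    ∃ K : ℝ, 0 < K ∧
      ∀ (N : ℕ) (H : Finset (Fin (N / 2 + 1))) (hH : H.Nonempty),
        (∀ μ ∈ H, (LCQNN.blockDim N μ : ℝ) ≤ Q.eval (N : ℝ)) →
        ∀ (A : LCQNN.Network N H), A.BlocksAreTwoDesigns →
        ∀ (O : LCQNN.Qubits N →L[ℂ] LCQNN.Qubits N), LCQNN.IsBlockObservable H O →
          Differentiable ℝ (A.cost O) ∧
          (∀ i : A.Param,
            MemLp (A.partialCost O i) 2 A.law ∧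
            ∫ x, A.partialCost O i x ∂A.law = 0 ∧
            variance (A.partialCost O i) A.law ≤ K * ‖O‖ ^ 2 / (H.card * (N + 1)) ∧
            variance (A.partialCost O i) A.law ≤
              K * ‖O‖ ^ 2 / (H.card * (H.inf' hH (LCQNN.blockDim N) : ℕ))) ∧
          (∀ (μ : H) (l : Fin (A.gates μ)),
            variance (A.partialCost O (Sum.inr ⟨μ, l⟩)) A.law ≤
              2 * ‖O‖ ^ 2 / (H.card * LCQNN.blockDim N μ)) := by
  obtain ⟨B, hB⟩ := LCQNN.exists_card_le Q
  -- For an angle of the tree `4 L² ≤ 4 B³ / L`; for a gate the constant is `2`. The sum covers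
  -- both, and the outer `4` comes from `N + 1 ≤ 4 D`.
  refine ⟨4 * (4 * (B : ℝ) ^ 3 + 2), by positivity, fun N H hH hQ A hA O hO =>
    ⟨A.differentiable_cost hO, fun i => ?_, A.variance_partialCost_inr_le hA hO⟩⟩
  set d := H.inf' hH (LCQNN.blockDim N) with hd
  obtain ⟨μ₀, hμ₀, hdμ₀⟩ := H.exists_mem_eq_inf' hH (LCQNN.blockDim N)
  have hd0 : (0 : ℝ) < d := by
    have := A.blockDim_pos ⟨μ₀, hμ₀⟩
    rw [hd, hdμ₀]
    exact_mod_cast this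
  have hdle : ∀ μ ∈ H, (d : ℝ) ≤ LCQNN.blockDim N μ := fun μ hμ => by
    exact_mod_cast Finset.inf'_le _ hμ
  have hN : (N : ℝ) + 1 ≤ 4 * d := by
    have := LCQNN.succ_le_four_mul_blockDim μ₀
    rw [hd, hdμ₀]
    exact_mod_cast this
  have hL : (0 : ℝ) < H.card := by exact_mod_cast hH.card_pos
  have hLB : (H.card : ℝ) ≤ B := by exact_mod_cast hB N H hQ
  have hvar : variance (A.partialCost O i) A.law ≤
      (4 * (B : ℝ) ^ 3 + 2) * ‖O‖ ^ 2 / (H.card * d) := by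
    rcases i with i | ⟨μ, l⟩
    · refine (A.variance_partialCost_inl_le hA hO i hd0 hdle).trans ?_
      rw [div_le_div_iff₀ hd0 (by positivity)]
      have h3 : (H.card : ℝ) ^ 3 ≤ (B : ℝ) ^ 3 := pow_le_pow_left₀ hL.le hLB 3
      have h4 : 0 ≤ ‖O‖ ^ 2 * d := by positivity
      nlinarith [mul_le_mul_of_nonneg_right h3 h4]
    · refine (A.variance_partialCost_inr_le hA hO μ l).trans ?_
      refine div_le_div₀ (by positivity) ?_ (by positivity)
        (mul_le_mul_of_nonneg_left (hdle μ μ.2) hL.le)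
      have : 0 ≤ (B : ℝ) ^ 3 * ‖O‖ ^ 2 := by positivity
      nlinarith
  have hnn : 0 ≤ (4 * (B : ℝ) ^ 3 + 2) * ‖O‖ ^ 2 := by positivity
  refine ⟨A.memLp_partialCost hO i, A.integral_partialCost hO i, hvar.trans ?_, hvar.trans ?_⟩
  · rw [div_le_div_iff₀ (by positivity) (by positivity)]
    nlinarith [mul_le_mul_of_nonneg_left hN (mul_nonneg hnn hL.le)]
  · gcongr
    have : 0 ≤ (B : ℝ) ^ 3 := by positivity
    linarith
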